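/- Setting. Consider the time-varying impulsive system with inputs $$\dot x(t)=f(t,x(t),u(t))\ \ (t\notin\gamma),\qquad x(t)=x(t^-)+g(t,x(t^-),u(t))\ \ (t\in\gamma),\tag{1}$$ with $f,g:\mathbb R_{\ge0}\times\mathbb R^n\times\mathbb R^m\to\mathbb R^n$. An input $u\in\mathcal U$ is a Lebesgue measurable, locally essentially bounded function $[0,\infty)\to\mathbb R^m$; for every $u\in\mathcal U$ the map $(t,\xi)\mapsto f(t,\xi,u(t))$ is assumed to be a Carathéodory function. $\Gamma$ is the set of all (finite or infinite) strictly increasing sequences in $(0,\infty)$ without finite limit points, and $n^\gamma_{(s,t]}$ is the number of elements of $\gamma\in\Gamma$ in $(s,t]$. A solution from $(t_0,x_0)$, $t_0\ge0$, is a function $x:[t_0,T_x)\to\mathbb R^n$, $t_0<T_x\le\infty$, with $x(t_0)=x_0$ which on each nonempty intersection of $[t_0,T_x)$ with an interval $[\tau_k,\tau_{k+1})$ between consecutive impulse times (where $\tau_0=0$, and the last interval is unbounded if $\gamma$ is finite) is locally absolutely continuous and satisfies the differential equation almost everywhere, and which at every $\tau\in\gamma\cap(t_0,T_x)$ has a finite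 left limit and satisfies the jump equation. $\mathcal T(t_0,x_0,u,\gamma)$ is the set of maximally defined solutions. For an interval $I$ put $\|u_I\|_\gamma=\max\{\operatorname{ess\,sup}_{t\in I}|u(t)|,\ \sup_{t\in\gamma\cap I}|u(t)|\}$ (equal to $0$ if $I=\emptyset$). $\mathcal P$ is the set of continuous $\varphi:\mathbb R_{\ge0}\to\mathbb R_{\ge0}$ with $\varphi(0)=0$ and $\varphi(s)>0$ for $s>0$; $\mathcal K$ consists of the strictly increasing and $\mathcal K_\infty$ of the strictly increasing and unbounded functions in $\mathcal P$. $\mathcal{KL}$ is the set of continuous $\beta:\mathbb R_{\ge0}^2\to\mathbb R_{\ge0}$ with $\beta(\cdot,t)\in\mathcal K$ for all $t\ge 0$, $\beta(r,\cdot)$ strictly decreasing whenever positive and $\lim_{t\to\infty}\beta(r,t)=0$ for all $r\ge 0$. Let $h^o,h:\mathbb R_{\ge0}\times\mathbb R^n\to\mathbb R_{\ge0}$ and $\mathcal S\subset\Gamma$. System (1) is *weakly* (resp. *strongly*) $(h^o,h)$-ISS over $\mathcal S$ if there are $\beta\in\mathcal{KL}$ and $\rho\in\mathcal K_\infty$ such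 that for all $t_0\ge0$, $x_0\in\mathbb R^n$, $u\in\mathcal U$, $\gamma\in\mathcal S$, $x\in\mathcal T(t_0,x_0,u,\gamma)$ and $t\in[t_0,T_x)$, $$h(t,x(t))\le\beta\big(h^o(t_0,x_0),\,t-t_0\big)+\rho\big(\|u_{(t_0,t]}\|_\gamma\big)$$ (resp. the same inequality with $t-t_0+n^\gamma_{(t_0,t]}$ in place of $t-t_0$). $\mathcal S\subset\Gamma$ is *uniformly incrementally bounded* (UIB) if there is a continuous nondecreasing $\phi:\mathbb R_{>0}\to\mathbb R_{\ge0}$ with $n^\gamma_{(s,t]}\le\phi(t-s)$ for all $t>s\ge0$ and $\gamma\in\mathcal S$. For $\rho\ge0$, $\hat{\mathcal S}(\rho)$ is the set of $\gamma\in\Gamma$ such that for every $\varepsilon>0$ there is $T>0$ with $n^\gamma_{(s,s+t]}/t\le\rho+\varepsilon$ for all $t\ge T$, $s\ge0$; $\mathcal S\subset\hat{\mathcal S}(\rho)$ is a *uniform subset* of $\hat{\mathcal S}(\rho)$ if $T=T(\varepsilon)$ can be chosen independently of $\gamma\in\mathcal S$. A locally Lipschitz function $V:\mathbb R_{\ge0}\times\mathbb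 R^n\to\mathbb R$ is an $(h^o,h)$-ISS Lyapunov function candidate for (1), with rate functions $p,\varphi,\psi$, where $p:\mathbb R_{\ge0}\to\mathbb R_{\ge0}$ is locally integrable, $\varphi:\mathbb R_{\ge0}\to\mathbb R$ is continuous and $\psi\in\mathcal P$, if there are $\phi_1,\phi_2,\chi,\pi\in\mathcal K_\infty$ such that $\phi_1(h(t,\xi))\le V(t,\xi)\le\phi_2(h^o(t,\xi))$ for all $t\ge 0$, $\xi\in\mathbb R^n$, and for all $t\ge0$, $\xi\in\mathbb R^n$, $\mu\in\mathbb R^m$: (i) $\displaystyle\limsup_{r\to0^+}\tfrac{V(t+r,\xi+rf(t,\xi,\mu))-V(t,\xi)}{r}\le-p(t)\varphi(V(t,\xi))$ if $V(t,\xi)\ge\chi(|\mu|)$; (ii) $V(t,\xi+g(t,\xi,\mu))\le\psi(V(t,\xi))$ if $V(t,\xi)\ge\chi(|\mu|)$; (iii) $V(t,\xi+g(t,\xi,\mu))\le\pi(|\mu|)$ if $V(t,\xi)\le\chi(|\mu|)$. **Theorem.** Let $V$ be an $(h^o,h)$-ISS Lyapunov function candidate for (1) with rate functions $p,\varphi,\psi$,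 where $\psi,\varphi\in\mathcal P$. Suppose that there exists $\theta>0$ such that $$M:=\sup_{a>0}\int_a^{\psi(a)}\frac{ds}{\varphi(s)}\;<\;\inf_{t\ge0}\int_t^{t+\theta}p(s)\,ds=:N.$$ Then the following hold. (a) If $M>0$, then (1) is strongly $(h^o,h)$-ISS over every uniform subset $\mathcal S$ of $\hat{\mathcal S}(1/\theta)$. (b) If $M=0$, then (1) is weakly $(h^o,h)$-ISS over $\Gamma$ and strongly $(h^o,h)$-ISS over every UIB family $\mathcal S\subset\Gamma$. (c) If $M<0<N$, then (1) is strongly $(h^o,h)$-ISS over $\Gamma$. -/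

import Mathlib

open MeasureTheory Filter Topology Set

namespace ImpulsiveISS

/-! Comparison functions. They are functions on `[0, ∞)`, represented by functions `ℝ → ℝ` whose
values at negative arguments are never used. -/

/-- Class `𝒫`: continuous on `[0, ∞)`, zero at zero, positive on `(0, ∞)`. -/
structure ClassP (φ : ℝ → ℝ) : Prop where
  continuousOn : ContinuousOn φ (Ici 0)
  zero : φ 0 = 0
  pos : ∀ s, 0 < s → 0 < φ s

/-- Class `𝒦`: continuous and strictly increasing on `[0, ∞)`, zero at zero. -/
structure ClassK (φ : ℝ → ℝ) : Prop where
  continuousOn : ContinuousOn φ (Ici 0)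
  zero : φ 0 = 0
  strictMonoOn : StrictMonoOn φ (Ici 0)

/-- Class `𝒦_∞`: class `𝒦` and unbounded. -/
structure ClassKInf (φ : ℝ → ℝ) : Prop extends ClassK φ where
  unbounded : ∀ C : ℝ, ∃ s, 0 ≤ s ∧ C < φ s

/-- Class `𝒦ℒ`. -/
structure ClassKL (β : ℝ → ℝ → ℝ) : Prop where
  continuousOn : ContinuousOn (fun q : ℝ × ℝ => β q.1 q.2) (Ici 0 ×ˢ Ici 0)
  classK : ∀ t, 0 ≤ t → ClassK (fun r => β r t)
  decreasing : ∀ r, 0 ≤ r → ∀ t₁ t₂, 0 ≤ t₁ → t₁ < t₂ → 0 < β r t₁ → β r t₂ < β r t₁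
  tendsto_zero : ∀ r, 0 ≤ r → Tendsto (fun t => β r t) atTop (𝓝 0)

/-! Inputs and impulse-time sequences. -/

/-- The set `𝒰` of inputs: Lebesgue measurable, locally essentially bounded functions on
`[0, ∞)`. -/
def Inputs (m : ℕ) : Set (ℝ → EuclideanSpace ℝ (Fin m)) :=
  {u | AEMeasurable u (volume.restrict (Ici 0)) ∧
    ∀ T : ℝ, ∃ C : ℝ, ∀ᵐ t ∂(volume.restrict (Icc 0 T)), ‖u t‖ ≤ C}

/-- The set `Γ` of impulse-time sequences. A finite or infinite strictly increasing sequence in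
`(0, ∞)` without finite limit points is identified with the set of its elements. -/
def ImpulseSeqs : Set (Set ℝ) :=
  {γ | γ ⊆ Ioi 0 ∧ ∀ T : ℝ, (γ ∩ Icc 0 T).Finite}

/-- The number of impulse times in `(s, t]`. -/
noncomputable def numImpulses (γ : Set ℝ) (s t : ℝ) : ℕ := (γ ∩ Ioc s t).ncard

/-- `‖u_I‖_γ`: the maximum of the essential supremum of `|u|` on `I` and of the supremum of `|u|`
on `γ ∩ I` (zero if `I` is empty). -/
noncomputable def inputNorm {m : ℕ} (u : ℝ → EuclideanSpace ℝ (Fin m)) (γ I : Set ℝ) : ENNReal :=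
  max (essSup (fun t => ‖u t‖ₑ) (volume.restrict I)) (⨆ t ∈ γ ∩ I, ‖u t‖ₑ)

/-- Uniformly incrementally bounded families of impulse-time sequences. -/
def IsUIB (S : Set (Set ℝ)) : Prop :=
  S ⊆ ImpulseSeqs ∧ ∃ φ : ℝ → ℝ, ContinuousOn φ (Ioi 0) ∧ MonotoneOn φ (Ioi 0) ∧
    (∀ r, 0 < r → 0 ≤ φ r) ∧
    ∀ γ ∈ S, ∀ s t, 0 ≤ s → s < t → (numImpulses γ s t : ℝ) ≤ φ (t - s)

/-- Sequences whose impulse frequency is eventually uniformly upper bounded by `ρ`. -/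
def EventuallyUpperBounded (ρ : ℝ) : Set (Set ℝ) :=
  {γ | γ ∈ ImpulseSeqs ∧ ∀ ε, 0 < ε → ∃ T, 0 < T ∧
    ∀ t, T ≤ t → ∀ s, 0 ≤ s → (numImpulses γ s (s + t) : ℝ) / t ≤ ρ + ε}

/-- Uniform subsets of `EventuallyUpperBounded ρ`: the time `T` does not depend on the sequence. -/
def IsUniformSubset (S : Set (Set ℝ)) (ρ : ℝ) : Prop :=
  S ⊆ EventuallyUpperBounded ρ ∧ ∀ ε, 0 < ε → ∃ T, 0 < T ∧
    ∀ γ ∈ S, ∀ t, T ≤ t → ∀ s, 0 ≤ s → (numImpulses γ s (s + t) : ℝ) / t ≤ ρ + ε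

/-! The impulsive system and its solutions. -/

/-- Carathéodory functions on `[0, ∞) × ℝⁿ`: measurable in time, continuous in the state, and
dominated on compact sets by an integrable function of time. -/
structure IsCaratheodory {n : ℕ}
    (F : ℝ → EuclideanSpace ℝ (Fin n) → EuclideanSpace ℝ (Fin n)) : Prop where
  measurable : ∀ ξ, AEMeasurable (fun t => F t ξ) (volume.restrict (Ici 0))
  continuous : ∀ᵐ t ∂(volume.restrict (Ici 0)), Continuous (F t)
  dominated : ∀ (T : ℝ) (K : Set (EuclideanSpace ℝ (Fin n))), IsCompact K →
    ∃ b : ℝ → ℝ, IntegrableOn b (Icc 0 T) ∧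
      ∀ᵐ t ∂(volume.restrict (Icc 0 T)), ∀ ξ ∈ K, ‖F t ξ‖ ≤ b t

/-- `x : [t₀, T) → ℝⁿ` (with `T ≤ ∞`) is a solution of
`x' = f(t, x, u)` for `t ∉ γ`, `x(t) = x(t⁻) + g(t, x(t⁻), u(t))` for `t ∈ γ`,
starting from `x₀` at time `t₀`. Values of `x` outside `[t₀, T)` are irrelevant. The compact
intervals `[a, b]` of `[t₀, T)` with no impulse time in `(a, b]` are those contained in an interval
`[τ_k, τ_{k+1}) ∩ [t₀, T)` between consecutive impulse times. -/
structure IsSolution {n m : ℕ}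
    (f g : ℝ → EuclideanSpace ℝ (Fin n) → EuclideanSpace ℝ (Fin m) → EuclideanSpace ℝ (Fin n))
    (t₀ : ℝ) (x₀ : EuclideanSpace ℝ (Fin n)) (u : ℝ → EuclideanSpace ℝ (Fin m)) (γ : Set ℝ)
    (x : ℝ → EuclideanSpace ℝ (Fin n)) (T : EReal) : Prop where
  lt_end : (t₀ : EReal) < T
  initial : x t₀ = x₀
  absolutelyContinuous : ∀ a b : ℝ, t₀ ≤ a → a ≤ b → (b : EReal) < T → γ ∩ Ioc a b = ∅ →
    AbsolutelyContinuousOnInterval x a b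
  flow : ∀ᵐ t : ℝ, t₀ < t → (t : EReal) < T → HasDerivAt x (f t (x t) (u t)) t
  jump : ∀ τ ∈ γ, t₀ < τ → (τ : EReal) < T →
    ∃ y, Tendsto x (𝓝[<] τ) (𝓝 y) ∧ x τ = y + g τ y (u τ)

/-- Maximally defined solutions: those without a proper extension to the right. -/
def IsMaximalSolution {n m : ℕ}
    (f g : ℝ → EuclideanSpace ℝ (Fin n) → EuclideanSpace ℝ (Fin m) → EuclideanSpace ℝ (Fin n))
    (t₀ : ℝ) (x₀ : EuclideanSpace ℝ (Fin n)) (u : ℝ → EuclideanSpace ℝ (Fin m)) (γ : Set ℝ)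
    (x : ℝ → EuclideanSpace ℝ (Fin n)) (T : EReal) : Prop :=
  IsSolution f g t₀ x₀ u γ x T ∧
    ¬ ∃ (y : ℝ → EuclideanSpace ℝ (Fin n)) (T' : EReal), IsSolution f g t₀ x₀ u γ y T' ∧
      T < T' ∧ ∀ t : ℝ, t₀ ≤ t → (t : EReal) < T → y t = x t

/-! Input-to-state stability in two measures. -/

/-- Weak `(h°, h)`-ISS over the family `S` of impulse-time sequences. -/
def WeaklyISS {n m : ℕ}
    (f g : ℝ → EuclideanSpace ℝ (Fin n) → EuclideanSpace ℝ (Fin m) → EuclideanSpace ℝ (Fin n))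
    (ho h : ℝ → EuclideanSpace ℝ (Fin n) → ℝ) (S : Set (Set ℝ)) : Prop :=
  ∃ (β : ℝ → ℝ → ℝ) (ρ : ℝ → ℝ), ClassKL β ∧ ClassKInf ρ ∧
    ∀ (t₀ : ℝ) (x₀ : EuclideanSpace ℝ (Fin n)) (u : ℝ → EuclideanSpace ℝ (Fin m)) (γ : Set ℝ)
      (x : ℝ → EuclideanSpace ℝ (Fin n)) (T : EReal),
      0 ≤ t₀ → u ∈ Inputs m → γ ∈ S → IsMaximalSolution f g t₀ x₀ u γ x T →
      ∀ t : ℝ, t₀ ≤ t → (t : EReal) < T →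
        h t (x t) ≤ β (ho t₀ x₀) (t - t₀) + ρ (inputNorm u γ (Ioc t₀ t)).toReal

/-- Strong `(h°, h)`-ISS over the family `S` of impulse-time sequences. -/
def StronglyISS {n m : ℕ}
    (f g : ℝ → EuclideanSpace ℝ (Fin n) → EuclideanSpace ℝ (Fin m) → EuclideanSpace ℝ (Fin n))
    (ho h : ℝ → EuclideanSpace ℝ (Fin n) → ℝ) (S : Set (Set ℝ)) : Prop :=
  ∃ (β : ℝ → ℝ → ℝ) (ρ : ℝ → ℝ), ClassKL β ∧ ClassKInf ρ ∧
    ∀ (t₀ : ℝ) (x₀ : EuclideanSpace ℝ (Fin n)) (u : ℝ → EuclideanSpace ℝ (Fin m)) (γ : Set ℝ)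
      (x : ℝ → EuclideanSpace ℝ (Fin n)) (T : EReal),
      0 ≤ t₀ → u ∈ Inputs m → γ ∈ S → IsMaximalSolution f g t₀ x₀ u γ x T →
      ∀ t : ℝ, t₀ ≤ t → (t : EReal) < T →
        h t (x t) ≤ β (ho t₀ x₀) (t - t₀ + (numImpulses γ t₀ t : ℝ))
          + ρ (inputNorm u γ (Ioc t₀ t)).toReal

/-! Lyapunov function candidates. -/

/-- The upper-right Dini derivative of `V` at `(t, ξ)` in the direction `(1, v)`. Along the flow
map `f` at `(t, ξ, μ)` it is taken with `v = f(t, ξ, μ)`. -/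
noncomputable def diniDeriv {n : ℕ} (V : ℝ → EuclideanSpace ℝ (Fin n) → ℝ)
    (t : ℝ) (ξ v : EuclideanSpace ℝ (Fin n)) : EReal :=
  limsup (fun r : ℝ => (((V (t + r) (ξ + r • v) - V t ξ) / r : ℝ) : EReal)) (𝓝[>] 0)

/-- `V` is an `(h°, h)`-ISS Lyapunov function candidate for the system with flow map `f` and jump
map `g`, with rate functions `p`, `φ` (flow) and `ψ` (jumps). -/
structure IsISSLyapunovCandidate {n m : ℕ}
    (f g : ℝ → EuclideanSpace ℝ (Fin n) → EuclideanSpace ℝ (Fin m) → EuclideanSpace ℝ (Fin n))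
    (ho h : ℝ → EuclideanSpace ℝ (Fin n) → ℝ) (V : ℝ → EuclideanSpace ℝ (Fin n) → ℝ)
    (p φ ψ : ℝ → ℝ) : Prop where
  locallyLipschitz : LocallyLipschitzOn (Ici 0 ×ˢ univ)
    (fun q : ℝ × EuclideanSpace ℝ (Fin n) => V q.1 q.2)
  bounds : ∃ φ₁ φ₂ : ℝ → ℝ, ClassKInf φ₁ ∧ ClassKInf φ₂ ∧
    ∀ t, 0 ≤ t → ∀ ξ, φ₁ (h t ξ) ≤ V t ξ ∧ V t ξ ≤ φ₂ (ho t ξ)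
  p_nonneg : ∀ t, 0 ≤ t → 0 ≤ p t
  p_locallyIntegrable : LocallyIntegrableOn p (Ici 0)
  φ_continuousOn : ContinuousOn φ (Ici 0)
  ψ_classP : ClassP ψ
  decrease : ∃ χ π : ℝ → ℝ, ClassKInf χ ∧ ClassKInf π ∧
    ∀ t, 0 ≤ t → ∀ (ξ : EuclideanSpace ℝ (Fin n)) (μ : EuclideanSpace ℝ (Fin m)),
      (χ ‖μ‖ ≤ V t ξ → diniDeriv V t ξ (f t ξ μ) ≤ ((-(p t) * φ (V t ξ) : ℝ) : EReal)) ∧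
      (χ ‖μ‖ ≤ V t ξ → V t (ξ + g t ξ μ) ≤ ψ (V t ξ)) ∧
      (V t ξ ≤ χ ‖μ‖ → V t (ξ + g t ξ μ) ≤ π ‖μ‖)

end ImpulsiveISS

open ImpulsiveISS

namespace ImpulsiveISS

/-! ### Comparison functions -/

/-! The potential `P(w) = ∫₁ʷ ds / φ(s)` turns the nonlinear decrease into a linear one. While `V`
stays above the level set by the input, `P(V)` falls along flows at rate at least `p`
(`potential_le_along_flow`) and rises by at most `M` at a jump. Hence `P(V(t)) ≤ P(V(s)) - ∫ p + M
n`, with `n` the number of impulses in between. Each window of length `θ` contributes at least `N`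
to the integral (`linear_le_integral`). So `M < N` and the bounds on the impulse count make the net
change at most `C - k · clock`, where `clock` is elapsed time, with impulses added in the strong
case.

Two difficulties remain. First, `P` may be bounded near `0` or near infinity, so `exp ∘ P` need not
be of class `𝒦_∞`, and a bound on `P(V)` need not bound `V`. If `V(t) ≤ V(s)`, a smaller rate
`min(φ, id)` yields a `𝒦_∞` function `E` that decays at least as fast
(`ClassP.exists_classKInf_exp_potential`). If `V(t) > V(s)`, the potential has increased, so `k ·
clock < C`. In case (a) this leaves boundedly many impulses, and iterates of a majorant of `ψ` bound
the growth; in the other cases `ψ` is at most the identity.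

Second, the decrease is known only above the input level. A trajectory is therefore compared either
with its initial value or with an earlier moment at which it was small
(`IsHybridTrajectory.controlledFrom`). The first comparison gives `β`, the second `ρ`, and
`exists_iss_bound` combines them. -/

lemma ClassK.mono {f : ℝ → ℝ} (hf : ClassK f) {x y : ℝ} (hx : 0 ≤ x) (hxy : x ≤ y) : f x ≤ f y :=
  hf.strictMonoOn.monotoneOn hx (hx.trans hxy) hxy

lemma ClassK.strictMono {f : ℝ → ℝ} (hf : ClassK f) {x y : ℝ} (hx : 0 ≤ x) (hxy : x < y) :
    f x < f y :=
  hf.strictMonoOn hx (hx.trans hxy.le) hxy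

lemma ClassK.nonneg {f : ℝ → ℝ} (hf : ClassK f) {x : ℝ} (hx : 0 ≤ x) : 0 ≤ f x :=
  hf.zero ▸ hf.mono le_rfl hx

lemma ClassK.pos {f : ℝ → ℝ} (hf : ClassK f) {x : ℝ} (hx : 0 < x) : 0 < f x :=
  hf.zero ▸ hf.strictMono le_rfl hx

lemma ClassKInf.id : ClassKInf (fun x => x) where
  continuousOn := continuousOn_id
  zero := rfl
  strictMonoOn := fun _ _ _ _ h => h
  unbounded C := ⟨max C 0 + 1, by positivity, by linarith [le_max_left C 0]⟩

lemma ClassK.comp {f g : ℝ → ℝ} (hf : ClassK f) (hg : ClassK g) : ClassK (fun x => f (g x)) where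
  continuousOn := hf.continuousOn.comp hg.continuousOn fun _ hx => hg.nonneg hx
  zero := by rw [hg.zero, hf.zero]
  strictMonoOn := fun _ hx _ _ hxy => hf.strictMono (hg.nonneg hx) (hg.strictMono hx hxy)

lemma ClassKInf.comp {f g : ℝ → ℝ} (hf : ClassKInf f) (hg : ClassKInf g) :
    ClassKInf (fun x => f (g x)) where
  toClassK := hf.toClassK.comp hg.toClassK
  unbounded C := by
    obtain ⟨s, hs, hC⟩ := hf.unbounded C
    obtain ⟨r, hr, hsr⟩ := hg.unbounded s
    exact ⟨r, hr, hC.trans (hf.strictMono hs hsr)⟩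

lemma ClassKInf.add {f g : ℝ → ℝ} (hf : ClassKInf f) (hg : ClassKInf g) :
    ClassKInf (fun x => f x + g x) where
  continuousOn := hf.continuousOn.add hg.continuousOn
  zero := by simp [hf.zero, hg.zero]
  strictMonoOn := fun _ hx _ _ hxy => add_lt_add (hf.strictMono hx hxy) (hg.strictMono hx hxy)
  unbounded C := by
    obtain ⟨s, hs, hC⟩ := hf.unbounded C
    exact ⟨s, hs, by linarith [hg.nonneg hs]⟩

lemma ClassKInf.iterate {f : ℝ → ℝ} (hf : ClassKInf f) : ∀ k : ℕ, ClassKInf (f^[k])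
  | 0 => ClassKInf.id
  | k + 1 => (hf.iterate k).comp hf

/-- A class `𝒦_∞` function has an inverse of class `𝒦_∞`. -/
lemma ClassKInf.exists_inverse {f : ℝ → ℝ} (hf : ClassKInf f) :
    ∃ e : ℝ → ℝ, ClassKInf e ∧ ∀ x, 0 ≤ x → e (f x) = x := by
  -- Continued by the identity on negative arguments, `f` becomes an increasing bijection of the
  -- line, whose inverse is automatically continuous.
  let F : ℝ → ℝ := fun x => if 0 ≤ x then f x else x
  have hF : StrictMono F := by
    intro x y hxy
    by_cases hx : 0 ≤ x
    · simpa [F, hx, hx.trans hxy.le] using hf.strictMono hx hxy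
    · by_cases hy : 0 ≤ y
      · simp only [F, hx, hy, if_true, if_false]
        linarith [hf.nonneg hy]
      · simpa [F, hx, hy] using hxy
  have hsurj : Function.Surjective F := by
    intro y
    by_cases hy : 0 ≤ y
    · obtain ⟨s, hs, hys⟩ := hf.unbounded y
      obtain ⟨z, hz, hzy⟩ := intermediate_value_Icc hs
        (hf.continuousOn.mono Icc_subset_Ici_self) ⟨hf.zero.le.trans hy, hys.le⟩
      exact ⟨z, by simpa [F, hz.1] using hzy⟩
    · exact ⟨y, by simp [F, hy]⟩
  let e := hF.orderIsoOfSurjective F hsurj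
  have he : ∀ x, 0 ≤ x → e.symm (f x) = x := by
    intro x hx
    rw [OrderIso.symm_apply_eq]
    simp [e, F, hx]
  refine ⟨e.symm, ⟨⟨e.symm.continuous.continuousOn, ?_, e.symm.strictMono.strictMonoOn _⟩, ?_⟩, he⟩
  · simpa [hf.zero] using he 0 le_rfl
  · intro C
    have hC : 0 ≤ max C 0 + 1 := by positivity
    refine ⟨f (max C 0 + 1), hf.nonneg hC, ?_⟩
    rw [he _ hC]
    linarith [le_max_left C 0]

/-- A class `𝒫` function has a class `𝒦_∞` majorant that is at least the identity. -/
lemma exists_classKInf_majorant {ψ : ℝ → ℝ} (hψ : ClassP ψ) :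
    ∃ Ψ : ℝ → ℝ, ClassKInf Ψ ∧ (∀ x, 0 ≤ x → x ≤ Ψ x) ∧ ∀ x, 0 ≤ x → ψ x ≤ Ψ x := by
  -- The majorant is the identity plus the running maximum of `ψ` over `[0, x]`. Writing the points
  -- of `[0, x]` as `l * x` keeps the index set fixed, so that continuity follows from compactness.
  let q : ℝ → ℝ → ℝ := fun x l => ψ (max (l * x) 0)
  have hq : Continuous (fun z : ℝ × ℝ => q z.1 z.2) :=
    hψ.continuousOn.comp_continuous (f := fun z : ℝ × ℝ => max (z.2 * z.1) 0) (by fun_prop)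
      fun z => mem_Ici.2 (le_max_right _ _)
  let Q : ℝ → ℝ := fun x => sSup (q x '' Icc 0 1)
  have hQ : Continuous Q := isCompact_Icc.continuous_sSup hq
  have hbdd : ∀ x, BddAbove (q x '' Icc 0 1) := fun x =>
    (isCompact_Icc.image (hq.comp (Continuous.prodMk_right x))).bddAbove
  have hle : ∀ x, 0 ≤ x → ψ x ≤ Q x := fun x hx =>
    le_csSup (hbdd x) ⟨1, by simp, by simp [q, hx]⟩
  have hmono : MonotoneOn Q (Ici 0) := by
    intro x (hx : 0 ≤ x) y (hy : 0 ≤ y) hxy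
    refine csSup_le_csSup (hbdd y) ⟨_, 0, by simp, rfl⟩ ?_
    rintro _ ⟨l, hl, rfl⟩
    rcases hy.eq_or_lt with rfl | hy
    · obtain rfl : x = 0 := le_antisymm hxy hx
      exact ⟨l, hl, rfl⟩
    · refine ⟨l * (x / y), ⟨by have := hl.1; positivity, ?_⟩, ?_⟩
      · exact mul_le_one₀ hl.2 (by positivity) ((div_le_one hy).2 hxy)
      · simp only [q]
        rw [mul_assoc, div_mul_cancel₀ _ hy.ne']
  have hzero : Q 0 = 0 := by
    have : q 0 '' Icc 0 1 = {0} := by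
      refine (Set.Nonempty.image_const (s := Icc (0:ℝ) 1) ⟨0, by simp⟩ (0:ℝ)) ▸ ?_
      exact image_congr fun l _ => by simp [q, hψ.zero]
    simp [Q, this]
  have hpos : ∀ x, 0 ≤ x → 0 ≤ Q x := fun x hx => hzero ▸ hmono self_mem_Ici hx hx
  refine ⟨fun x => x + Q x, ⟨⟨(continuous_id.add hQ).continuousOn, by simp [hzero], ?_⟩, ?_⟩,
    fun x hx => by linarith [hpos x hx], fun x hx => by linarith [hle x hx]⟩
  · intro x hx y hy hxy
    exact add_lt_add_of_lt_of_le hxy (hmono hx hy hxy.le)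
  · intro C
    have hC : 0 ≤ max C 0 + 1 := by positivity
    exact ⟨_, hC, by linarith [le_max_left C 0, hpos _ hC]⟩

lemma ClassKInf.classKL_exp {e G : ℝ → ℝ} (he : ClassKInf e) (hG : ClassKInf G) (C : ℝ) {k : ℝ}
    (hk : 0 < k) : ClassKL (fun r s => e (Real.exp (C - k * s) * G r)) where
  continuousOn := by
    refine he.continuousOn.comp (ContinuousOn.mul (by fun_prop) ?_) ?_
    · exact hG.continuousOn.comp continuousOn_fst fun q hq => hq.1
    · exact fun q hq => mul_nonneg (Real.exp_pos _).le (hG.nonneg hq.1)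
  classK t _ :=
    { continuousOn := he.continuousOn.comp (continuousOn_const.mul hG.continuousOn)
        fun r hr => mul_nonneg (Real.exp_pos _).le (hG.nonneg hr)
      zero := by simp [hG.zero, he.zero]
      strictMonoOn := fun r hr r' _ hrr => he.strictMono
        (mul_nonneg (Real.exp_pos _).le (hG.nonneg hr))
        (mul_lt_mul_of_pos_left (hG.strictMono hr hrr) (Real.exp_pos _)) }
  decreasing r hr t₁ t₂ _ ht hpos := by
    have hGr : 0 < G r := by
      refine (hG.nonneg hr).lt_of_ne' fun h0 => ?_
      simp [h0, he.zero] at hpos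
    refine he.strictMono (by positivity) (mul_lt_mul_of_pos_right ?_ hGr)
    exact Real.exp_lt_exp.2 (by nlinarith)
  tendsto_zero r hr := by
    have h1 : Tendsto (fun t : ℝ => Real.exp (C - k * t) * G r) atTop (𝓝 0) := by
      have : Tendsto (fun t : ℝ => C - k * t) atTop atBot := by
        have h := tendsto_neg_atTop_atBot.comp (tendsto_id.const_mul_atTop hk)
        simp only [sub_eq_add_neg]
        exact tendsto_atBot_add_const_left _ C h
      simpa using (Real.tendsto_exp_atBot.comp this).mul_const (G r)
    have h2 : Tendsto (fun t : ℝ => Real.exp (C - k * t) * G r) atTop (𝓝[Ici 0] 0) :=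
      tendsto_nhdsWithin_iff.2 ⟨h1, Eventually.of_forall fun t =>
        mul_nonneg (Real.exp_pos _).le (hG.nonneg hr)⟩
    have h3 := (he.continuousOn 0 self_mem_Ici).tendsto.comp h2
    rwa [he.zero] at h3

/-! ### The potential of a rate function -/

lemma ClassP.continuousOn_inv {φ : ℝ → ℝ} (hφ : ClassP φ) :
    ContinuousOn (fun s => 1 / φ s) (Ioi 0) :=
  continuousOn_const.div (hφ.continuousOn.mono Ioi_subset_Ici_self) fun s hs => (hφ.pos s hs).ne'

lemma ClassP.intervalIntegrable_inv {φ : ℝ → ℝ} (hφ : ClassP φ) {a b : ℝ} (ha : 0 < a)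
    (hb : 0 < b) : IntervalIntegrable (fun s => 1 / φ s) volume a b :=
  (hφ.continuousOn_inv.mono fun _ hx => (lt_min ha hb).trans_le hx.1).intervalIntegrable

/-- The potential `w ↦ ∫₁ʷ ds / φ(s)`. -/
noncomputable def potential (φ : ℝ → ℝ) (w : ℝ) : ℝ := ∫ s in (1 : ℝ)..w, 1 / φ s

lemma ClassP.potential_sub {φ : ℝ → ℝ} (hφ : ClassP φ) {a b : ℝ} (ha : 0 < a) (hb : 0 < b) :
    potential φ b - potential φ a = ∫ s in a..b, 1 / φ s :=
  intervalIntegral.integral_interval_sub_left (hφ.intervalIntegrable_inv one_pos hb)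
    (hφ.intervalIntegrable_inv one_pos ha)

lemma ClassP.hasDerivAt_potential {φ : ℝ → ℝ} (hφ : ClassP φ) {w : ℝ} (hw : 0 < w) :
    HasDerivAt (potential φ) (1 / φ w) w :=
  intervalIntegral.integral_hasDerivAt_right (hφ.intervalIntegrable_inv one_pos hw)
    (hφ.continuousOn_inv.stronglyMeasurableAtFilter isOpen_Ioi w hw)
    (hφ.continuousOn_inv.continuousAt (Ioi_mem_nhds hw))

lemma ClassP.continuousOn_potential {φ : ℝ → ℝ} (hφ : ClassP φ) :
    ContinuousOn (potential φ) (Ioi 0) :=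
  fun _ hw => (hφ.hasDerivAt_potential hw).continuousAt.continuousWithinAt

lemma ClassP.strictMonoOn_potential {φ : ℝ → ℝ} (hφ : ClassP φ) :
    StrictMonoOn (potential φ) (Ioi 0) := by
  refine strictMonoOn_of_deriv_pos (convex_Ioi 0) hφ.continuousOn_potential fun w hw => ?_
  rw [interior_Ioi] at hw
  rw [(hφ.hasDerivAt_potential hw).deriv]
  exact one_div_pos.2 (hφ.pos w hw)

lemma ClassP.min_id {φ : ℝ → ℝ} (hφ : ClassP φ) : ClassP (fun s => min (φ s) s) where
  continuousOn := ContinuousOn.inf hφ.continuousOn continuousOn_id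
  zero := by simp [hφ.zero]
  pos s hs := lt_min (hφ.pos s hs) hs

lemma potential_id {w : ℝ} (hw : 0 < w) : potential (fun s => s) w = Real.log w := by
  rw [potential, integral_one_div_of_pos one_pos hw, div_one]

/-- A class `𝒦_∞` function that grows at least as fast as the exponential of the potential. -/
lemma ClassP.exists_classKInf_exp_potential {φ : ℝ → ℝ} (hφ : ClassP φ) :
    ∃ E : ℝ → ℝ, ClassKInf E ∧ ∀ a b, 0 < a → a ≤ b →
      E a ≤ Real.exp (potential φ a - potential φ b) * E b := by
  have hid : ClassP (fun s => s) := ⟨continuousOn_id, rfl, fun s hs => hs⟩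
  -- A smaller rate has larger potential increments. Staying below `φ` gives the decay estimate.
  -- Staying below the identity forces `E w ≤ w` on `(0, 1]` and `w ≤ E w` beyond `1`, hence
  -- continuity at `0` and unboundedness.
  set μ : ℝ → ℝ := fun s => min (φ s) s with hμdef
  have hμ : ClassP μ := hφ.min_id
  have hcmp : ∀ {η : ℝ → ℝ}, ClassP η → (∀ s, 0 < s → μ s ≤ η s) → ∀ a b, 0 < a → a ≤ b →
      potential η b - potential η a ≤ potential μ b - potential μ a := by
    intro η hη hle a b ha hab
    rw [hη.potential_sub ha (ha.trans_le hab), hμ.potential_sub ha (ha.trans_le hab)]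
    refine intervalIntegral.integral_mono_on hab (hη.intervalIntegrable_inv ha (ha.trans_le hab))
      (hμ.intervalIntegrable_inv ha (ha.trans_le hab)) fun s hs => ?_
    have hs0 := ha.trans_le hs.1
    exact one_div_le_one_div_of_le (hμ.pos s hs0) (hle s hs0)
  have hlog := hcmp hid fun s _ => min_le_right _ _
  have hone : ∀ η : ℝ → ℝ, potential η 1 = 0 := fun η => by simp [potential]
  let E : ℝ → ℝ := fun w => if 0 < w then Real.exp (potential μ w) else 0
  have hEpos : ∀ {w}, 0 < w → E w = Real.exp (potential μ w) := fun hw => by simp [E, hw]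
  have hsmall : ∀ w, 0 < w → w ≤ 1 → E w ≤ w := by
    intro w hw hw1
    have := hlog w 1 hw hw1
    rw [potential_id hw, hone, hone] at this
    rw [hEpos hw, ← Real.le_log_iff_exp_le hw]
    linarith
  have hlarge : ∀ w, 1 ≤ w → w ≤ E w := by
    intro w hw
    have h0 : 0 < w := one_pos.trans_le hw
    have := hlog 1 w one_pos hw
    rw [potential_id h0, hone, hone] at this
    rw [hEpos h0, ← Real.log_le_iff_le_exp h0]
    linarith
  refine ⟨E, ⟨⟨?_, by simp [E], ?_⟩, ?_⟩, ?_⟩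
  · intro w (hw : 0 ≤ w)
    rcases hw.eq_or_lt with rfl | hw
    · have h0 : E 0 = 0 := by simp [E]
      rw [ContinuousWithinAt, h0]
      refine tendsto_of_tendsto_of_tendsto_of_le_of_le' (h := fun w => w) tendsto_const_nhds
        (tendsto_id.mono_left inf_le_left) ?_ ?_
      · exact Eventually.of_forall fun w => by
          simp only [E]; split_ifs <;> positivity
      · filter_upwards [self_mem_nhdsWithin, mem_nhdsWithin_of_mem_nhds (Iio_mem_nhds one_pos)]
          with w hw hw1
        rcases (show (0:ℝ) ≤ w from hw).eq_or_lt with rfl | hw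
        · exact h0.le
        · exact hsmall w hw (le_of_lt hw1)
    · have : E =ᶠ[𝓝 w] fun w => Real.exp (potential μ w) :=
        (eventually_gt_nhds hw).mono fun _ h => hEpos h
      exact ((hμ.hasDerivAt_potential hw).continuousAt.rexp.congr this.symm).continuousWithinAt
  · intro a (ha : 0 ≤ a) b _ hab
    have hb : 0 < b := ha.trans_lt hab
    rcases ha.eq_or_lt with rfl | ha
    · simp [E, hb, Real.exp_pos]
    · rw [hEpos ha, hEpos hb]
      exact Real.exp_lt_exp.2 (hμ.strictMonoOn_potential ha hb hab)
  · intro C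
    exact ⟨max C 0 + 1, by positivity,
      lt_of_lt_of_le (by linarith [le_max_left C 0]) (hlarge _ (by linarith [le_max_right C 0]))⟩
  · intro a b ha hab
    rw [hEpos ha, hEpos (ha.trans_le hab), ← Real.exp_add, Real.exp_le_exp]
    linarith [hcmp hφ (fun s _ => min_le_left _ _) a b ha hab]

/-! ### Decrease of the potential along the flow -/

lemma absolutelyContinuousOnInterval_lipschitz_comp {X Y : Type*} [PseudoMetricSpace X]
    [PseudoMetricSpace Y] {f : ℝ → X} {g : X → Y} {s : Set X} {K : NNReal} {a b : ℝ}
    (hf : AbsolutelyContinuousOnInterval f a b)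
    (hg : ∀ y ∈ s, ∀ z ∈ s, dist (g y) (g z) ≤ K * dist y z)
    (hfs : MapsTo f (uIcc a b) s) : AbsolutelyContinuousOnInterval (fun t => g (f t)) a b := by
  rw [absolutelyContinuousOnInterval_iff] at hf ⊢
  intro ε hε
  obtain ⟨δ, hδ, h⟩ := hf (ε / (K + 1)) (by positivity)
  refine ⟨δ, hδ, fun I hI hIδ => ?_⟩
  calc ∑ i ∈ Finset.range I.1, dist (g (f (I.2 i).1)) (g (f (I.2 i).2))
      ≤ ∑ i ∈ Finset.range I.1, K * dist (f (I.2 i).1) (f (I.2 i).2) :=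
        Finset.sum_le_sum fun i hi =>
          hg _ (hfs (hI.1 i hi).1) _ (hfs (hI.1 i hi).2)
    _ = K * ∑ i ∈ Finset.range I.1, dist (f (I.2 i).1) (f (I.2 i).2) := by rw [Finset.mul_sum]
    _ ≤ K * (ε / (K + 1)) := by gcongr; exact (h I hI hIδ).le
    _ < ε := by
        rw [mul_div_assoc', div_lt_iff₀ (by positivity)]
        nlinarith

lemma absolutelyContinuousOnInterval_prodMk {X Y : Type*} [PseudoMetricSpace X]
    [PseudoMetricSpace Y] {f : ℝ → X} {g : ℝ → Y} {a b : ℝ}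
    (hf : AbsolutelyContinuousOnInterval f a b) (hg : AbsolutelyContinuousOnInterval g a b) :
    AbsolutelyContinuousOnInterval (fun t => (f t, g t)) a b := by
  unfold AbsolutelyContinuousOnInterval at *
  refine squeeze_zero (fun t => Finset.sum_nonneg fun _ _ => dist_nonneg) (fun t => ?_)
    (by simpa using hf.add hg)
  rw [← Finset.sum_add_distrib]
  refine Finset.sum_le_sum fun i _ => ?_
  rw [Prod.dist_eq]
  exact max_le_add_of_nonneg dist_nonneg dist_nonneg

/-- The graph of `x` over `[a, b]` is compact, so `V` has a single Lipschitz constant on it. -/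
lemma absolutelyContinuousOnInterval_along {n : ℕ} {V : ℝ → EuclideanSpace ℝ (Fin n) → ℝ}
    (hV : LocallyLipschitzOn (Ici 0 ×ˢ univ) (fun q : ℝ × EuclideanSpace ℝ (Fin n) => V q.1 q.2))
    {x : ℝ → EuclideanSpace ℝ (Fin n)} {a b : ℝ} (ha : 0 ≤ a) (hab : a ≤ b)
    (hx : AbsolutelyContinuousOnInterval x a b) :
    AbsolutelyContinuousOnInterval (fun t => V t (x t)) a b := by
  have hid : AbsolutelyContinuousOnInterval (fun t : ℝ => t) a b :=
    (LipschitzWith.id.lipschitzOnWith (s := uIcc a b)).absolutelyContinuousOnInterval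
  have hpair : AbsolutelyContinuousOnInterval (fun t => (t, x t)) a b :=
    absolutelyContinuousOnInterval_prodMk hid hx
  have hcpt : IsCompact ((fun t => (t, x t)) '' uIcc a b) :=
    isCompact_uIcc.image_of_continuousOn hpair.continuousOn
  have hsub : (fun t => (t, x t)) '' uIcc a b ⊆ Ici 0 ×ˢ univ := by
    rintro _ ⟨t, ht, rfl⟩
    rw [uIcc_of_le hab] at ht
    exact ⟨ha.trans ht.1, mem_univ _⟩
  obtain ⟨K, hK⟩ := LocallyLipschitzOn.exists_lipschitzOnWith_of_compact hcpt (hV.mono hsub)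
  have := absolutelyContinuousOnInterval_lipschitz_comp hpair hK.dist_le_mul (mapsTo_image _ _)
  exact this

/-- For locally Lipschitz `V`, the Dini derivative in the direction of the velocity of a curve is
the derivative along the curve, wherever both exist. -/
lemma diniDeriv_eq_deriv {n : ℕ} {V : ℝ → EuclideanSpace ℝ (Fin n) → ℝ}
    (hV : LocallyLipschitzOn (Ici 0 ×ˢ univ) (fun q : ℝ × EuclideanSpace ℝ (Fin n) => V q.1 q.2))
    {x : ℝ → EuclideanSpace ℝ (Fin n)} {v : EuclideanSpace ℝ (Fin n)} {t : ℝ} (ht : 0 < t)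
    (hx : HasDerivAt x v t) (hW : DifferentiableAt ℝ (fun s => V s (x s)) t) :
    diniDeriv V t (x t) v = (deriv (fun s => V s (x s)) t : ℝ) := by
  obtain ⟨K, U, hU, hK⟩ := hV (x := (t, x t)) ⟨ht.le, mem_univ _⟩
  rw [nhdsWithin_eq_nhds.2 (prod_mem_nhds (Ici_mem_nhds ht) univ_mem)] at hU
  have hmono : 𝓝[>] (0 : ℝ) ≤ 𝓝[≠] 0 := nhdsWithin_mono _ fun r hr => ne_of_gt hr
  have h1 := (hasDerivAt_iff_tendsto_slope_zero.1 hW.hasDerivAt).mono_left hmono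
  have h2 := (hasDerivAt_iff_tendsto_slope_zero.1 hx).mono_left hmono
  -- Replacing the curve by its tangent costs at most `K` times their distance, which is `o(r)`.
  have h3 : Tendsto (fun r : ℝ => (V (t + r) (x t + r • v) - V (t + r) (x (t + r))) / r)
      (𝓝[>] 0) (𝓝 0) := by
    have hbound : Tendsto (fun r : ℝ => K * ‖v - r⁻¹ • (x (t + r) - x t)‖) (𝓝[>] 0) (𝓝 0) := by
      simpa using ((tendsto_const_nhds (x := v)).sub h2).norm.const_mul (K : ℝ)
    refine squeeze_zero_norm' ?_ hbound
    have e1 : ∀ᶠ r : ℝ in 𝓝[>] 0, (t + r, x t + r • v) ∈ U := by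
      refine Filter.Tendsto.eventually (f := fun r : ℝ => (t + r, x t + r • v)) ?_ hU
      have : Continuous fun r : ℝ => (t + r, x t + r • v) := by fun_prop
      have h0 := this.tendsto 0
      rw [add_zero, zero_smul, add_zero] at h0
      exact h0.mono_left inf_le_left
    have e2 : ∀ᶠ r : ℝ in 𝓝[>] 0, (t + r, x (t + r)) ∈ U := by
      refine Filter.Tendsto.eventually (f := fun r : ℝ => (t + r, x (t + r))) ?_ hU
      have ha : Tendsto (fun r : ℝ => t + r) (𝓝 0) (𝓝 t) := by
        simpa using (continuous_const_add t).tendsto 0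
      exact (ha.prodMk_nhds (hx.continuousAt.tendsto.comp ha)).mono_left inf_le_left
    filter_upwards [e1, e2, self_mem_nhdsWithin] with r h1 h2 (hr : 0 < r)
    have := hK.dist_le_mul _ h1 _ h2
    rw [norm_div, Real.norm_of_nonneg hr.le, div_le_iff₀ hr, ← dist_eq_norm]
    refine this.trans_eq ?_
    have hdist : dist (x t + r • v) (x (t + r)) = r * ‖v - r⁻¹ • (x (t + r) - x t)‖ := by
      rw [dist_eq_norm, ← norm_smul_of_nonneg hr.le, smul_sub, smul_inv_smul₀ hr.ne']
      congr 1
      abel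
    rw [Prod.dist_eq, dist_self, max_eq_right dist_nonneg, hdist]
    ring
  have h4 : Tendsto (fun r : ℝ => (V (t + r) (x t + r • v) - V t (x t)) / r) (𝓝[>] 0)
      (𝓝 (deriv (fun s => V s (x s)) t)) := by
    have := h3.add h1
    rw [zero_add] at this
    refine this.congr fun r => ?_
    rw [smul_eq_mul]
    ring
  exact ((continuous_coe_real_ereal.tendsto _).comp h4).limsup_eq

/-- On `[a, b]` the values of `V` stay in a compact subset of `(0, ∞)`, where the potential is
Lipschitz. The composite is thus absolutely continuous, and its derivative, at most `-p` almost
everywhere, may be integrated. -/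
theorem potential_le_along_flow {n : ℕ} {V : ℝ → EuclideanSpace ℝ (Fin n) → ℝ}
    (hV : LocallyLipschitzOn (Ici 0 ×ˢ univ) (fun q : ℝ × EuclideanSpace ℝ (Fin n) => V q.1 q.2))
    {p φ : ℝ → ℝ} (hφ : ClassP φ) {x v : ℝ → EuclideanSpace ℝ (Fin n)} {a b c : ℝ}
    (ha : 0 ≤ a) (hab : a ≤ b) (hx : AbsolutelyContinuousOnInterval x a b)
    (hv : ∀ᵐ t : ℝ, t ∈ Ioo a b → HasDerivAt x (v t) t)
    (hD : ∀ᵐ t : ℝ, t ∈ Ioo a b →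
      diniDeriv V t (x t) (v t) ≤ ((-(p t) * φ (V t (x t)) : ℝ) : EReal))
    (hp : IntervalIntegrable p volume a b) (hc : 0 < c) (hW : ∀ t ∈ Icc a b, c ≤ V t (x t)) :
    potential φ (V b (x b)) ≤ potential φ (V a (x a)) - ∫ t in a..b, p t := by
  have hWac := absolutelyContinuousOnInterval_along hV ha hab hx
  obtain ⟨C, hC⟩ := hWac.exists_bound
  rw [uIcc_of_le hab] at hC
  have hmaps : MapsTo (fun t => V t (x t)) (uIcc a b) (Icc c C) := by
    rw [uIcc_of_le hab]
    exact fun t ht => ⟨hW t ht, (le_abs_self _).trans (hC t ht)⟩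
  have hpos : Icc c C ⊆ Ioi 0 := fun w hw => hc.trans_le hw.1
  obtain ⟨B, hB⟩ := isCompact_Icc.exists_bound_of_continuousOn (hφ.continuousOn_inv.mono hpos)
  have hlip : LipschitzOnWith B.toNNReal (potential φ) (Icc c C) :=
    (convex_Icc c C).lipschitzOnWith_of_nnnorm_hasDerivWithin_le
      (fun w hw => (hφ.hasDerivAt_potential (hpos hw)).hasDerivWithinAt) fun w hw => by
        rw [← NNReal.coe_le_coe, coe_nnnorm]
        exact (hB w hw).trans (Real.le_coe_toNNReal _)
  have hF := absolutelyContinuousOnInterval_lipschitz_comp hWac hlip.dist_le_mul hmaps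
  have hint := hF.integral_deriv_eq_sub
  have hle : ∫ t in a..b, deriv (fun t => potential φ (V t (x t))) t ≤ ∫ t in a..b, -p t := by
    refine intervalIntegral.integral_mono_ae_restrict hab hF.intervalIntegrable_deriv hp.neg ?_
    rw [← restrict_Ioo_eq_restrict_Icc, EventuallyLE, ae_restrict_iff' measurableSet_Ioo]
    filter_upwards [hv, hD, hWac.ae_differentiableAt] with t h1 h2 h3 ht
    have htIcc := Ioo_subset_Icc_self ht
    have hWt := hW t htIcc
    specialize h3 (by rwa [uIcc_of_le hab])
    have hφpos := hφ.pos _ (hc.trans_le hWt)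
    have hd := h2 ht
    rw [diniDeriv_eq_deriv hV (ha.trans_lt ht.1) (h1 ht) h3, EReal.coe_le_coe_iff] at hd
    have hder := (hφ.hasDerivAt_potential (hc.trans_le hWt)).comp t h3.hasDerivAt
    have heq : deriv (fun t => potential φ (V t (x t))) t
      = 1 / φ (V t (x t)) * deriv (fun s => V s (x s)) t := hder.deriv
    rw [heq, one_div_mul_eq_div, div_le_iff₀ hφpos]
    exact hd
  rw [hint, intervalIntegral.integral_neg] at hle
  linarith

/-! ### Counting impulses -/

lemma finite_inter_Ioc {γ : Set ℝ} (hγ : γ ∈ ImpulseSeqs) {s : ℝ} (hs : 0 ≤ s) (t : ℝ) :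
    (γ ∩ Ioc s t).Finite :=
  (hγ.2 t).subset fun _ hr => ⟨hr.1, hs.trans hr.2.1.le, hr.2.2⟩

lemma numImpulses_eq_zero {γ : Set ℝ} {s t : ℝ} (h : γ ∩ Ioc s t = ∅) : numImpulses γ s t = 0 := by
  rw [numImpulses, h, ncard_empty]

lemma numImpulses_add {γ : Set ℝ} (hγ : γ ∈ ImpulseSeqs) {r s t : ℝ} (hr : 0 ≤ r) (hrs : r ≤ s)
    (hst : s ≤ t) : numImpulses γ r t = numImpulses γ r s + numImpulses γ s t := by
  rw [numImpulses, numImpulses, numImpulses, ← Ioc_union_Ioc_eq_Ioc hrs hst,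
    inter_union_distrib_left]
  refine ncard_union_eq ?_ (finite_inter_Ioc hγ hr s) (finite_inter_Ioc hγ (hr.trans hrs) t)
  exact Disjoint.mono inter_subset_right inter_subset_right
    (disjoint_left.2 fun _ h₁ h₂ => h₁.2.not_gt h₂.1)

lemma numImpulses_mono {γ : Set ℝ} (hγ : γ ∈ ImpulseSeqs) {s t t' : ℝ} (hs : 0 ≤ s)
    (htt : t ≤ t') : numImpulses γ s t ≤ numImpulses γ s t' :=
  ncard_le_ncard (inter_subset_inter_right _ (Ioc_subset_Ioc_right htt)) (finite_inter_Ioc hγ hs t')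

/-! ### Trajectories with jumps -/

/-- Between times `s` and `t`, the trajectory `W` loses at least `∫ p` in terms of the potential
`P`, except for a gain of at most `M` per impulse, and it grows at most like iterates of `Ψ`. -/
def GrowthBound (γ : Set ℝ) (W P p Ψ : ℝ → ℝ) (M s t : ℝ) : Prop :=
  0 < W s ∧ 0 < W t ∧
    P (W t) ≤ P (W s) - (∫ r in s..t, p r) + M * numImpulses γ s t ∧
    W t ≤ Ψ^[numImpulses γ s t] (W s)

/-- `W t ≤ d`, or `W t` is controlled by its value at time `s` or by some value at most `d`. -/
def ControlledFrom (γ : Set ℝ) (W P p Ψ : ℝ → ℝ) (M d s t : ℝ) : Prop :=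
  W t ≤ d ∨ ∃ r ∈ Icc s t, (r = s ∨ W r ≤ d) ∧ GrowthBound γ W P p Ψ M r t

lemma GrowthBound.trans {γ : Set ℝ} {W P p Ψ : ℝ → ℝ} {M r s t : ℝ} (hγ : γ ∈ ImpulseSeqs)
    (hΨ : ClassKInf Ψ) (hp : ∀ a b, 0 ≤ a → 0 ≤ b → IntervalIntegrable p volume a b)
    (hr : 0 ≤ r) (hrs : r ≤ s) (hst : s ≤ t) (h₁ : GrowthBound γ W P p Ψ M r s)
    (h₂ : GrowthBound γ W P p Ψ M s t) : GrowthBound γ W P p Ψ M r t := by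
  obtain ⟨hWr, hWs, hP₁, hΨ₁⟩ := h₁
  obtain ⟨-, hWt, hP₂, hΨ₂⟩ := h₂
  refine ⟨hWr, hWt, ?_, ?_⟩
  · rw [numImpulses_add hγ hr hrs hst, ← intervalIntegral.integral_add_adjacent_intervals
      (hp r s hr (hr.trans hrs)) (hp s t (hr.trans hrs) (hr.trans (hrs.trans hst)))]
    push_cast
    linarith
  · rw [numImpulses_add hγ hr hrs hst, add_comm, Function.iterate_add_apply]
    exact hΨ₂.trans ((hΨ.iterate _).mono hWs.le hΨ₁)

lemma ControlledFrom.trans {γ : Set ℝ} {W P p Ψ : ℝ → ℝ} {M d r s t : ℝ} (hγ : γ ∈ ImpulseSeqs)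
    (hΨ : ClassKInf Ψ) (hp : ∀ a b, 0 ≤ a → 0 ≤ b → IntervalIntegrable p volume a b)
    (hr : 0 ≤ r) (hrs : r ≤ s) (hst : s ≤ t) (h₁ : ControlledFrom γ W P p Ψ M d r s)
    (h₂ : ControlledFrom γ W P p Ψ M d s t) : ControlledFrom γ W P p Ψ M d r t := by
  rcases h₂ with h₂ | ⟨q, hq, hqW, hG⟩
  · exact Or.inl h₂
  rcases hqW with rfl | hqW
  · rcases h₁ with h₁ | ⟨q', hq', hqW', hG'⟩
    · exact Or.inr ⟨q, ⟨hrs, hst⟩, Or.inr h₁, hG⟩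
    · exact Or.inr ⟨q', ⟨hq'.1, hq'.2.trans hst⟩, hqW',
        hG'.trans hγ hΨ hp (hr.trans hq'.1) hq'.2 hst hG⟩
  · exact Or.inr ⟨q, ⟨hrs.trans hq.1, hq.2⟩, Or.inr hqW, hG⟩

/-- A trajectory that is continuous and decreases between impulse times while it is at least `c`,
and whose jumps are controlled by `ψ` above the level `c` and lead to values at most `d` below it. -/
structure IsHybridTrajectory (γ : Set ℝ) (W P p ψ : ℝ → ℝ) (c d t₀ t₁ : ℝ) : Prop where
  continuousOn : ∀ a b, t₀ ≤ a → a ≤ b → b ≤ t₁ → γ ∩ Ioc a b = ∅ → ContinuousOn W (Icc a b)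
  flow : ∀ a b, t₀ ≤ a → a ≤ b → b ≤ t₁ → γ ∩ Ioc a b = ∅ → (∀ r ∈ Icc a b, c ≤ W r) →
    P (W b) ≤ P (W a) - ∫ r in a..b, p r
  jump : ∀ τ ∈ γ, t₀ < τ → τ ≤ t₁ → ∃ w, Tendsto W (𝓝[<] τ) (𝓝 w) ∧
    (w ≤ c → W τ ≤ d) ∧ (c ≤ w → W τ ≤ ψ w)

section

variable {γ : Set ℝ} {W P p ψ Ψ : ℝ → ℝ} {M c d t₀ t₁ : ℝ}

lemma IsHybridTrajectory.growthBound_of_flow (h : IsHybridTrajectory γ W P p ψ c d t₀ t₁)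
    (hP : StrictMonoOn P (Ioi 0)) (hp0 : ∀ t, 0 ≤ t → 0 ≤ p t) (ht₀ : 0 ≤ t₀) (hc : 0 < c)
    {a b : ℝ} (ha : t₀ ≤ a) (hab : a ≤ b) (hb : b ≤ t₁) (hγ : γ ∩ Ioc a b = ∅)
    (hW : ∀ r ∈ Icc a b, c ≤ W r) : GrowthBound γ W P p Ψ M a b := by
  have hWa := hc.trans_le (hW a ⟨le_rfl, hab⟩)
  have hWb := hc.trans_le (hW b ⟨hab, le_rfl⟩)
  have hflow := h.flow a b ha hab hb hγ hW
  refine ⟨hWa, hWb, by simpa [numImpulses_eq_zero hγ] using hflow, ?_⟩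
  rw [numImpulses_eq_zero hγ, Function.iterate_zero_apply]
  refine (hP.le_iff_le hWb hWa).1 (hflow.trans (sub_le_self _ ?_))
  exact intervalIntegral.integral_nonneg hab fun r hr => hp0 r (ht₀.trans (ha.trans hr.1))

lemma IsHybridTrajectory.controlledFrom_of_flow (h : IsHybridTrajectory γ W P p ψ c d t₀ t₁)
    (hP : StrictMonoOn P (Ioi 0)) (hp0 : ∀ t, 0 ≤ t → 0 ≤ p t) (ht₀ : 0 ≤ t₀) (hc : 0 < c)
    (hcd : c ≤ d) {a b : ℝ} (ha : t₀ ≤ a) (hab : a ≤ b) (hb : b ≤ t₁) (hγ : γ ∩ Ioc a b = ∅) :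
    ControlledFrom γ W P p Ψ M d a b := by
  by_cases hall : ∀ r ∈ Icc a b, d < W r
  · exact Or.inr ⟨a, ⟨le_rfl, hab⟩, Or.inl rfl, h.growthBound_of_flow hP hp0 ht₀ hc ha hab hb hγ
      fun r hr => hcd.trans (hall r hr).le⟩
  push Not at hall
  have hcont := h.continuousOn a b ha hab hb hγ
  have hclosed : IsClosed (Icc a b ∩ W ⁻¹' Iic d) := hcont.preimage_isClosed_of_isClosed
    isClosed_Icc isClosed_Iic
  have hcompact : IsCompact (Icc a b ∩ W ⁻¹' Iic d) :=
    isCompact_Icc.of_isClosed_subset hclosed inter_subset_left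
  -- This is the last time with `W ≤ d`. If `W b > d`, continuity gives `W r = d` there, so `W ≥ d ≥
  -- c` from then on and the flow estimate applies.
  obtain ⟨r, ⟨hr, hrd⟩, hmax⟩ := hcompact.exists_isGreatest hall
  by_cases hbd : W b ≤ d
  · exact Or.inl hbd
  push Not at hbd
  obtain ⟨r', hr', hr'd⟩ := intermediate_value_Icc hr.2 (hcont.mono (Icc_subset_Icc_left hr.1))
    ⟨hrd, hbd.le⟩
  obtain rfl : r' = r := le_antisymm (hmax ⟨⟨hr.1.trans hr'.1, hr'.2⟩, hr'd.le⟩) hr'.1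
  refine Or.inr ⟨r', hr, Or.inr hrd, h.growthBound_of_flow hP hp0 ht₀ hc (ha.trans hr.1) hr.2 hb ?_ ?_⟩
  · exact subset_eq_empty (inter_subset_inter_right _ (Ioc_subset_Ioc_left hr.1)) hγ
  · intro q hq
    refine hcd.trans ?_
    by_contra! hqd
    have : q = r' := le_antisymm (hmax ⟨⟨hr.1.trans hq.1, hq.2⟩, hqd.le⟩) hq.1
    rw [this, hr'd] at hqd
    exact hqd.false

lemma IsHybridTrajectory.controlledFrom_of_jump (h : IsHybridTrajectory γ W P p ψ c d t₀ t₁)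
    (hγΓ : γ ∈ ImpulseSeqs)
    (hP : StrictMonoOn P (Ioi 0)) (hPcont : ContinuousOn P (Ioi 0)) (hp0 : ∀ t, 0 ≤ t → 0 ≤ p t)
    (hp : ∀ a b, 0 ≤ a → 0 ≤ b → IntervalIntegrable p volume a b)
    (hΨ : ClassKInf Ψ) (hψΨ : ∀ w, 0 ≤ w → ψ w ≤ Ψ w) (hψ : ∀ w, 0 < w → 0 < ψ w)
    (hM : ∀ w, 0 < w → P (ψ w) ≤ P w + M)
    (ht₀ : 0 ≤ t₀) (hc : 0 < c) (hcd : c ≤ d) {a τ : ℝ} (ha : t₀ ≤ a) (haτ : a < τ) (hτ : τ ≤ t₁)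
    (hτγ : τ ∈ γ) (hγ : γ ∩ Ioo a τ = ∅) : ControlledFrom γ W P p Ψ M d a τ := by
  obtain ⟨w, hw, hjc, hjψ⟩ := h.jump τ hτγ (ha.trans_lt haτ) hτ
  rcases le_or_gt w c with hwc | hcw
  · exact Or.inl (hjc hwc)
  rcases le_or_gt (W τ) d with hτd | hdτ
  · exact Or.inl hτd
  -- The left limit exceeds `c`, so `W ≥ c` on some `[b, τ)`. The flow estimates there pass to the
  -- limit at `τ`, and the jump then adds at most `M`.
  have hev : ∀ᶠ r in 𝓝[<] τ, a < r ∧ c ≤ W r :=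
    (eventually_nhdsWithin_of_eventually_nhds (eventually_gt_nhds haτ)).and
      ((hw.eventually (lt_mem_nhds hcw)).mono fun _ h => h.le)
  obtain ⟨l, hl, hlτ⟩ := (mem_nhdsLT_iff_exists_Ioo_subset' haτ).1 hev
  obtain ⟨b, hlb, hbτ⟩ := exists_between (show l < τ from hl)
  have hab : a < b := (hlτ ⟨hlb, hbτ⟩).1
  have hb0 : 0 ≤ b := ht₀.trans (ha.trans hab.le)
  have hempty : ∀ q, q < τ → γ ∩ Ioc a q = ∅ := fun q hq =>
    subset_eq_empty (inter_subset_inter_right _ (Ioc_subset_Ioo_right hq)) hγ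
  refine (h.controlledFrom_of_flow hP hp0 ht₀ hc hcd ha hab.le (hbτ.le.trans hτ)
    (hempty b hbτ)).trans hγΓ hΨ hp (ht₀.trans ha) hab.le hbτ.le
    (Or.inr ⟨b, ⟨le_rfl, hbτ.le⟩, Or.inl rfl, ?_⟩)
  have hG : ∀ q ∈ Ico b τ, P (W q) ≤ P (W b) - (∫ r in b..q, p r) ∧ W q ≤ W b := by
    intro q hq
    have hemp : γ ∩ Ioc b q = ∅ :=
      subset_eq_empty (inter_subset_inter_right _ (Ioc_subset_Ioc_left hab.le)) (hempty q hq.2)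
    obtain ⟨-, -, h1, h2⟩ := h.growthBound_of_flow (Ψ := Ψ) (M := M) hP hp0 ht₀ hc
      (ha.trans hab.le) hq.1 (hq.2.le.trans hτ) hemp
      fun r hr => (hlτ ⟨hlb.trans_le hr.1, hr.2.trans_lt hq.2⟩).2
    rw [numImpulses_eq_zero hemp] at h1 h2
    exact ⟨by simpa using h1, h2⟩
  have hnear : ∀ᶠ q in 𝓝[<] τ, q ∈ Ico b τ := by
    filter_upwards [self_mem_nhdsWithin, mem_nhdsWithin_of_mem_nhds (Ioi_mem_nhds hbτ)]
      with q h1 h2 using ⟨le_of_lt h2, h1⟩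
  have hw0 : 0 < w := hc.trans hcw
  have hwb : w ≤ W b := le_of_tendsto hw (hnear.mono fun q hq => (hG q hq).2)
  have hPw : P w ≤ P (W b) - ∫ r in b..τ, p r := by
    have h1 : Tendsto (fun q => P (W q)) (𝓝[<] τ) (𝓝 (P w)) :=
      (hPcont.continuousAt (Ioi_mem_nhds hw0)).tendsto.comp hw
    have h2 : Tendsto (fun q => ∫ r in b..q, p r) (𝓝[<] τ) (𝓝 (∫ r in b..τ, p r)) := by
      have hc := intervalIntegral.continuousOn_primitive_interval'
        (hp b τ hb0 (hb0.trans hbτ.le)) left_mem_uIcc τ right_mem_uIcc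
      refine hc.tendsto.mono_left (nhdsWithin_le_of_mem ?_)
      rw [uIcc_of_le hbτ.le]
      exact Icc_mem_nhdsLT hbτ
    exact le_of_tendsto_of_tendsto h1 (tendsto_const_nhds.sub h2)
      (hnear.mono fun q hq => (hG q hq).1)
  have hWτ : 0 < W τ := (hc.trans_le hcd).trans hdτ
  have hone : numImpulses γ b τ = 1 := by
    have : γ ∩ Ioc b τ = {τ} := by
      refine Subset.antisymm (fun q hq => ?_) (by simpa using ⟨hτγ, hbτ⟩)
      by_contra hne
      have : q ∈ γ ∩ Ioo a τ := ⟨hq.1, hab.trans hq.2.1, lt_of_le_of_ne hq.2.2 hne⟩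
      rwa [hγ] at this
    rw [numImpulses, this, ncard_singleton]
  refine ⟨hw0.trans_le hwb, hWτ, ?_, ?_⟩
  · rw [hone]
    have := (hP.le_iff_le hWτ (hψ w hw0)).2 (hjψ hcw.le)
    have := hM w hw0
    push_cast
    linarith
  · rw [hone, Function.iterate_one]
    exact (hjψ hcw.le).trans ((hψΨ w hw0.le).trans (hΨ.mono hw0.le hwb))

theorem IsHybridTrajectory.controlledFrom (h : IsHybridTrajectory γ W P p ψ c d t₀ t₁)
    (hγΓ : γ ∈ ImpulseSeqs)
    (hP : StrictMonoOn P (Ioi 0)) (hPcont : ContinuousOn P (Ioi 0)) (hp0 : ∀ t, 0 ≤ t → 0 ≤ p t)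
    (hp : ∀ a b, 0 ≤ a → 0 ≤ b → IntervalIntegrable p volume a b)
    (hΨ : ClassKInf Ψ) (hψΨ : ∀ w, 0 ≤ w → ψ w ≤ Ψ w) (hψ : ∀ w, 0 < w → 0 < ψ w)
    (hM : ∀ w, 0 < w → P (ψ w) ≤ P w + M)
    (ht₀ : 0 ≤ t₀) (hc : 0 < c) (hcd : c ≤ d) (t : ℝ) (ht : t ∈ Icc t₀ t₁) :
    ControlledFrom γ W P p Ψ M d t₀ t := by
  -- Induction on the number of impulses: the last one, `τ`, is split off, together with the
  -- impulse-free stretches before and after it.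
  induction hk : numImpulses γ t₀ t using Nat.strong_induction_on generalizing t with
  | _ k ih =>
  rcases (γ ∩ Ioc t₀ t).eq_empty_or_nonempty with hemp | hne
  · exact h.controlledFrom_of_flow hP hp0 ht₀ hc hcd le_rfl ht.1 ht.2 hemp
  obtain ⟨τ, ⟨hτγ, hτ⟩, hτmax⟩ :=
    exists_max_image _ (fun r => r) (finite_inter_Ioc hγΓ ht₀ t) hne
  have hlast : γ ∩ Ioc τ t = ∅ := by
    refine eq_empty_of_forall_notMem fun q hq => ?_
    exact (hτmax q ⟨hq.1, hτ.1.trans hq.2.1, hq.2.2⟩).not_gt hq.2.1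
  obtain ⟨a, ha, haτ, hempty⟩ : ∃ a, t₀ ≤ a ∧ a < τ ∧ γ ∩ Ioo a τ = ∅ := by
    rcases (γ ∩ Ioo t₀ τ).eq_empty_or_nonempty with hemp | hne
    · exact ⟨t₀, le_rfl, hτ.1, hemp⟩
    obtain ⟨a, ⟨-, ha⟩, hamax⟩ := exists_max_image _ (fun r => r)
      ((finite_inter_Ioc hγΓ ht₀ τ).subset (inter_subset_inter_right _ Ioo_subset_Ioc_self)) hne
    refine ⟨a, ha.1.le, ha.2, eq_empty_of_forall_notMem fun q hq => ?_⟩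
    exact (hamax q ⟨hq.1, ha.1.trans hq.2.1, hq.2.2⟩).not_gt hq.2.1
  have hlt : numImpulses γ t₀ a < k := by
    rw [← hk]
    refine ncard_lt_ncard ⟨inter_subset_inter_right _
      (Ioc_subset_Ioc_right (haτ.le.trans hτ.2)), fun hsub => ?_⟩ (finite_inter_Ioc hγΓ ht₀ t)
    exact (hsub ⟨hτγ, hτ⟩).2.2.not_gt haτ
  have h1 := ih _ hlt a ⟨ha, haτ.le.trans (hτ.2.trans ht.2)⟩ rfl
  have h2 := h.controlledFrom_of_jump hγΓ hP hPcont hp0 hp hΨ hψΨ hψ hM ht₀ hc hcd ha haτ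
    (hτ.2.trans ht.2) hτγ hempty
  have h3 := h.controlledFrom_of_flow (Ψ := Ψ) (M := M) hP hp0 ht₀ hc hcd hτ.1.le hτ.2 ht.2 hlast
  exact (h1.trans hγΓ hΨ hp ht₀ ha haτ.le h2).trans hγΓ hΨ hp ht₀ hτ.1.le hτ.2 h3

end

/-! ### Integral of the decrease rate. -/

lemma intervalIntegrable_of_locallyIntegrableOn_Ici {p : ℝ → ℝ}
    (hp : LocallyIntegrableOn p (Ici 0)) {a b : ℝ} (ha : 0 ≤ a) (hb : 0 ≤ b) :
    IntervalIntegrable p volume a b :=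
  intervalIntegrable_iff.2 <| (hp.integrableOn_compact_subset
    (fun _ hx => (le_min ha hb).trans hx.1) isCompact_uIcc).mono_set uIoc_subset_uIcc

/-- `⌊(t - s) / θ⌋` full windows fit into `[s, t]`; the incomplete last window costs the additive
`N`. -/
lemma linear_le_integral {p : ℝ → ℝ} {θ N : ℝ} (hp0 : ∀ t, 0 ≤ t → 0 ≤ p t)
    (hp : ∀ a b, 0 ≤ a → 0 ≤ b → IntervalIntegrable p volume a b) (hθ : 0 < θ)
    (hN : ∀ t, 0 ≤ t → N ≤ ∫ r in t..(t + θ), p r) (hN0 : 0 ≤ N) {s t : ℝ} (hs : 0 ≤ s)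
    (hst : s ≤ t) : N / θ * (t - s) - N ≤ ∫ r in s..t, p r := by
  have hk : ∀ k : ℕ, k * N ≤ ∫ r in s..(s + k * θ), p r := by
    intro k
    induction k with
    | zero => simp
    | succ k ih =>
      have h0 : 0 ≤ s + k * θ := by positivity
      rw [← intervalIntegral.integral_add_adjacent_intervals (hp s (s + k * θ) hs h0)
        (hp (s + k * θ) _ h0 (by positivity))]
      have := hN _ h0
      rw [show s + ((k + 1 : ℕ) : ℝ) * θ = s + k * θ + θ by push_cast; ring]
      push_cast
      linarith
  have hnn : 0 ≤ (t - s) / θ := div_nonneg (sub_nonneg.2 hst) hθ.le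
  set k := ⌊(t - s) / θ⌋₊
  have h1 : k * θ ≤ t - s := (le_div_iff₀ hθ).1 (Nat.floor_le hnn)
  have h2 : (t - s) / θ ≤ k + 1 := (Nat.lt_floor_add_one _).le
  have h0 : 0 ≤ s + k * θ := by positivity
  rw [← intervalIntegral.integral_add_adjacent_intervals (hp s (s + k * θ) hs h0)
    (hp (s + k * θ) t h0 (hs.trans hst))]
  have h3 : 0 ≤ ∫ r in (s + k * θ)..t, p r :=
    intervalIntegral.integral_nonneg (by linarith) fun r hr => hp0 r (h0.trans hr.1)
  have h4 : N / θ * (t - s) = N * ((t - s) / θ) := by ring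
  have h5 : N * ((t - s) / θ) ≤ N * (k + 1) := mul_le_mul_of_nonneg_left h2 hN0
  linarith [hk k]

/-! ### Input norms, solutions as hybrid trajectories, and the ISS estimate. -/

section

variable {n m : ℕ} {u : ℝ → EuclideanSpace ℝ (Fin m)} {γ : Set ℝ}

/-- Since `toReal` sends `⊤` to `0`, finiteness is needed for the real-valued norm to bound the
input. -/
lemma inputNorm_ne_top (hu : u ∈ Inputs m) (hγ : γ ∈ ImpulseSeqs) {s : ℝ} (hs : 0 ≤ s) (t : ℝ) :
    inputNorm u γ (Ioc s t) ≠ ⊤ := by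
  obtain ⟨C, hC⟩ := hu.2 t
  have hsub : Ioc s t ⊆ Icc 0 t := fun r hr => ⟨hs.trans hr.1.le, hr.2⟩
  refine (max_lt ?_ ?_).ne
  · refine lt_of_le_of_lt (essSup_le_of_ae_le (ENNReal.ofReal C) ?_) ENNReal.ofReal_lt_top
    filter_upwards [ae_restrict_of_ae_restrict_of_subset hsub hC] with r hr
    rw [← ofReal_norm]
    exact ENNReal.ofReal_le_ofReal hr
  · have hfin := finite_inter_Ioc hγ hs t
    rcases (γ ∩ Ioc s t).eq_empty_or_nonempty with hemp | hne
    · simp [hemp]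
    · obtain ⟨τ, -, hτ⟩ := exists_max_image _ (fun t => ‖u t‖ₑ) hfin hne
      exact lt_of_le_of_lt (iSup₂_le hτ) enorm_lt_top

lemma norm_le_toReal_of_enorm_le {v : EuclideanSpace ℝ (Fin m)} {a : ENNReal} (ha : a ≠ ⊤)
    (h : ‖v‖ₑ ≤ a) : ‖v‖ ≤ a.toReal := by
  rw [← toReal_enorm]
  exact ENNReal.toReal_mono ha h

lemma ae_norm_le_inputNorm (hu : u ∈ Inputs m) (hγ : γ ∈ ImpulseSeqs) {s : ℝ} (hs : 0 ≤ s)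
    (t : ℝ) : ∀ᵐ r : ℝ, r ∈ Ioc s t → ‖u r‖ ≤ (inputNorm u γ (Ioc s t)).toReal := by
  rw [← ae_restrict_iff' measurableSet_Ioc]
  filter_upwards [ENNReal.ae_le_essSup (μ := volume.restrict (Ioc s t)) fun t => ‖u t‖ₑ] with r hr
  exact norm_le_toReal_of_enorm_le (inputNorm_ne_top hu hγ hs t) (hr.trans (le_max_left _ _))

lemma norm_le_inputNorm (hu : u ∈ Inputs m) (hγ : γ ∈ ImpulseSeqs) {s t τ : ℝ} (hs : 0 ≤ s)
    (hτ : τ ∈ γ ∩ Ioc s t) : ‖u τ‖ ≤ (inputNorm u γ (Ioc s t)).toReal :=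
  norm_le_toReal_of_enorm_le (inputNorm_ne_top hu hγ hs t) <|
    (le_iSup₂ (f := fun r (_ : r ∈ γ ∩ Ioc s t) => ‖u r‖ₑ) τ hτ).trans (le_max_right _ _)

variable
    {f g : ℝ → EuclideanSpace ℝ (Fin n) → EuclideanSpace ℝ (Fin m) → EuclideanSpace ℝ (Fin n)}
    {ho h V : ℝ → EuclideanSpace ℝ (Fin n) → ℝ} {p φ ψ Ψ χ π : ℝ → ℝ}

lemma isHybridTrajectory_of_isSolution
    (hV : LocallyLipschitzOn (Ici 0 ×ˢ univ) (fun q : ℝ × EuclideanSpace ℝ (Fin n) => V q.1 q.2))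
    (hV0 : ∀ t, 0 ≤ t → ∀ ξ, 0 ≤ V t ξ) (hφ : ClassP φ)
    (hp : ∀ a b, 0 ≤ a → 0 ≤ b → IntervalIntegrable p volume a b)
    (hΨ : ClassKInf Ψ) (hψΨ : ∀ w, 0 ≤ w → ψ w ≤ Ψ w) (hχ : ClassKInf χ) (hπ : ClassKInf π)
    (hdec : ∀ t, 0 ≤ t → ∀ (ξ : EuclideanSpace ℝ (Fin n)) (μ : EuclideanSpace ℝ (Fin m)),
      (χ ‖μ‖ ≤ V t ξ → diniDeriv V t ξ (f t ξ μ) ≤ ((-(p t) * φ (V t ξ) : ℝ) : EReal)) ∧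
      (χ ‖μ‖ ≤ V t ξ → V t (ξ + g t ξ μ) ≤ ψ (V t ξ)) ∧
      (V t ξ ≤ χ ‖μ‖ → V t (ξ + g t ξ μ) ≤ π ‖μ‖))
    {t₀ t₁ R d : ℝ} {x₀ : EuclideanSpace ℝ (Fin n)} {x : ℝ → EuclideanSpace ℝ (Fin n)} {T : EReal}
    (hx : IsSolution f g t₀ x₀ u γ x T) (ht₀ : 0 ≤ t₀) (ht₁ : (t₁ : EReal) < T) (hR : 0 < R)
    (hu : ∀ᵐ r : ℝ, r ∈ Ioc t₀ t₁ → ‖u r‖ ≤ R) (huγ : ∀ τ ∈ γ ∩ Ioc t₀ t₁, ‖u τ‖ ≤ R)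
    (hdΨ : Ψ (χ R) ≤ d) (hdπ : π R ≤ d) :
    IsHybridTrajectory γ (fun t => V t (x t)) (potential φ) p ψ (χ R) d t₀ t₁ where
  continuousOn a b ha hab hb hγ := by
    have := (absolutelyContinuousOnInterval_along hV (ht₀.trans ha) hab
      (hx.absolutelyContinuous a b ha hab
        ((EReal.coe_le_coe_iff.2 hb).trans_lt ht₁) hγ)).continuousOn
    rwa [uIcc_of_le hab] at this
  flow a b ha hab hb hγ hW := by
    have hbT : (b : EReal) < T := (EReal.coe_le_coe_iff.2 hb).trans_lt ht₁
    have hltT : ∀ r, r ∈ Ioo a b → (r : EReal) < T := fun r hr =>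
      (EReal.coe_lt_coe_iff.2 hr.2).trans hbT
    refine potential_le_along_flow hV hφ (v := fun t => f t (x t) (u t)) (ht₀.trans ha) hab
      (hx.absolutelyContinuous a b ha hab hbT hγ) ?_ ?_
      (hp a b (ht₀.trans ha) (ht₀.trans (ha.trans hab))) (hχ.pos hR) hW
    · filter_upwards [hx.flow] with r h1 hr
      exact h1 (ha.trans_lt hr.1) (hltT r hr)
    · filter_upwards [hu] with r h1 hr
      refine (hdec r (ht₀.trans (ha.trans hr.1.le)) (x r) (u r)).1 ?_
      exact (hχ.mono (norm_nonneg _) (h1 ⟨ha.trans_lt hr.1, hr.2.le.trans hb⟩)).trans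
        (hW r (Ioo_subset_Icc_self hr))
  jump τ hτ hτ₀ hτ₁ := by
    obtain ⟨y, hy, hjump⟩ := hx.jump τ hτ hτ₀ ((EReal.coe_le_coe_iff.2 hτ₁).trans_lt ht₁)
    have hτpos : 0 < τ := ht₀.trans_lt hτ₀
    have huR : ‖u τ‖ ≤ R := huγ τ ⟨hτ, hτ₀, hτ₁⟩
    have hχR : χ ‖u τ‖ ≤ χ R := hχ.mono (norm_nonneg _) huR
    obtain ⟨-, hψ', hπ'⟩ := hdec τ hτpos.le y (u τ)
    refine ⟨V τ y, ?_, fun hc => ?_, fun hc => ?_⟩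
    · have hcont : ContinuousAt (fun q : ℝ × EuclideanSpace ℝ (Fin n) => V q.1 q.2) (τ, y) :=
        hV.continuousOn.continuousAt (prod_mem_nhds (Ici_mem_nhds hτpos) univ_mem)
      exact hcont.tendsto.comp ((tendsto_id.mono_left inf_le_left).prodMk_nhds hy)
    · rw [hjump]
      -- Below the level `χ R` either jump condition may apply, as `χ ‖u τ‖` can be smaller; hence
      -- `d` must dominate both `Ψ (χ R)` and `π R`.
      rcases le_total (V τ y) (χ ‖u τ‖) with hle | hle
      · exact (hπ' hle).trans ((hπ.mono (norm_nonneg _) huR).trans hdπ)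
      · have hy0 := hV0 τ hτpos.le y
        exact (hψ' hle).trans ((hψΨ _ hy0).trans ((hΨ.mono hy0 hc).trans hdΨ))
    · rw [hjump]
      exact hψ' (hχR.trans hc)

/-- ISS with respect to a general measure `clock` of the elapsed time, provided that the decrease
of the potential during flows prevails over its increase at impulses. -/
theorem exists_iss_bound (hh : ∀ t, 0 ≤ t → ∀ ξ, 0 ≤ h t ξ)
    (hV : IsISSLyapunovCandidate f g ho h V p φ ψ) (hho : ∀ t, 0 ≤ t → ∀ ξ, 0 ≤ ho t ξ)
    (hφ : ClassP φ) {Ψ₁ : ℝ → ℝ} {M C k : ℝ}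
    (hM : ∀ a, 0 < a → ∫ s in a..(ψ a), 1 / φ s ≤ M) {S : Set (Set ℝ)} (hS : S ⊆ ImpulseSeqs)
    (clock : Set ℝ → ℝ → ℝ → ℝ) (hk : 0 < k) (hΨ : ClassKInf Ψ)
    (hψΨ : ∀ w, 0 ≤ w → ψ w ≤ Ψ w) (hΨ₁ : ClassKInf Ψ₁) (hidΨ₁ : ∀ w, 0 ≤ w → w ≤ Ψ₁ w)
    (hdecay : ∀ γ ∈ S, ∀ s t, 0 ≤ s → s ≤ t →
      -(∫ r in s..t, p r) + M * numImpulses γ s t ≤ C - k * clock γ s t)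
    (hgrowth : ∀ γ ∈ S, ∀ s t, 0 ≤ s → s ≤ t → k * clock γ s t ≤ C →
      ∀ w, 0 ≤ w → Ψ^[numImpulses γ s t] w ≤ Ψ₁ w) :
    ∃ (β : ℝ → ℝ → ℝ) (ρ : ℝ → ℝ), ClassKL β ∧ ClassKInf ρ ∧
    ∀ (t₀ : ℝ) (x₀ : EuclideanSpace ℝ (Fin n)) (u : ℝ → EuclideanSpace ℝ (Fin m)) (γ : Set ℝ)
      (x : ℝ → EuclideanSpace ℝ (Fin n)) (T : EReal),
      0 ≤ t₀ → u ∈ Inputs m → γ ∈ S → IsMaximalSolution f g t₀ x₀ u γ x T →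
      ∀ t : ℝ, t₀ ≤ t → (t : EReal) < T →
        h t (x t) ≤ β (ho t₀ x₀) (clock γ t₀ t) + ρ (inputNorm u γ (Ioc t₀ t)).toReal := by
  obtain ⟨φ₁, φ₂, hφ₁, hφ₂, hbounds⟩ := hV.bounds
  obtain ⟨χ, π, hχ, hπ, hdec⟩ := hV.decrease
  obtain ⟨E, hE, hEpot⟩ := hφ.exists_classKInf_exp_potential
  obtain ⟨e, he, heE⟩ := hE.exists_inverse
  obtain ⟨e₁, he₁, heφ₁⟩ := hφ₁.exists_inverse
  have hp : ∀ a b, 0 ≤ a → 0 ≤ b → IntervalIntegrable p volume a b := fun a b =>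
    intervalIntegrable_of_locallyIntegrableOn_Ici hV.p_locallyIntegrable
  have hV0 : ∀ t, 0 ≤ t → ∀ ξ, 0 ≤ V t ξ := fun t ht ξ =>
    (hφ₁.nonneg (hh t ht ξ)).trans (hbounds t ht ξ).1
  have hMpot : ∀ w, 0 < w → potential φ (ψ w) ≤ potential φ w + M := fun w hw => by
    have := hM w hw
    rw [← hφ.potential_sub hw (hV.ψ_classP.pos w hw)] at this
    linarith
  have hδ : ClassKInf (fun R => χ R + (Ψ (χ R) + π R)) := hχ.add ((hΨ.comp hχ).add hπ)
  set δ : ℝ → ℝ := fun R => χ R + (Ψ (χ R) + π R) with hδdef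
  have hρ : ClassKInf (fun R => e₁ (Ψ₁ (δ R))) := he₁.comp (hΨ₁.comp hδ)
  refine ⟨fun r s => e₁ (e (Real.exp (C - k * s) * E (Ψ₁ (φ₂ r)))), fun R => e₁ (Ψ₁ (δ R)),
    (he₁.comp he).classKL_exp (hE.comp (hΨ₁.comp hφ₂)) C hk, hρ, ?_⟩
  rintro t₀ x₀ u γ x T ht₀ hu hγS ⟨hx, -⟩ t ht htT
  have hγ := hS hγS
  set R₀ := (inputNorm u γ (Ioc t₀ t)).toReal with hR₀
  have hR₀0 : 0 ≤ R₀ := ENNReal.toReal_nonneg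
  have ht0 : 0 ≤ t := ht₀.trans ht
  -- If `V` has grown, so has its potential, which forces `k * clock ≤ C` and makes the growth
  -- hypothesis available.
  have hbound : ∀ r, t₀ ≤ r → r ≤ t →
      GrowthBound γ (fun t => V t (x t)) (potential φ) p Ψ M r t →
      V t (x t) ≤ V r (x r) ∨ (k * clock γ r t ≤ C ∧ V t (x t) ≤ Ψ₁ (V r (x r))) := by
    rintro r hr hrt ⟨hWr, hWt, hP, hit⟩
    rcases le_or_gt (V t (x t)) (V r (x r)) with hle | hlt
    · exact Or.inl hle
    have h1 := hφ.strictMonoOn_potential hWr hWt hlt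
    have h2 := hdecay γ hγS r t (ht₀.trans hr) hrt
    have h3 : k * clock γ r t ≤ C := by linarith
    exact Or.inr ⟨h3, hit.trans (hgrowth γ hγS r t (ht₀.trans hr) hrt h3 _ hWr.le)⟩
  -- The input norm may be `0`, whereas the potential needs a positive level; the estimate is proved
  -- for `R > R₀` and `R` then tends to `R₀`.
  have key : ∀ R, R₀ < R → h t (x t) ≤
      e₁ (e (Real.exp (C - k * clock γ t₀ t) * E (Ψ₁ (φ₂ (ho t₀ x₀))))) + e₁ (Ψ₁ (δ R)) := by
    intro R hR
    have hRpos : 0 < R := hR₀0.trans_lt hR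
    have hχR := hχ.pos hRpos
    have hΨχR := hΨ.nonneg hχR.le
    have hπR := hπ.nonneg hRpos.le
    have hδR := hδ.nonneg hRpos.le
    have hho₀ := hho t₀ ht₀ x₀
    have hG : 0 ≤ E (Ψ₁ (φ₂ (ho t₀ x₀))) := hE.nonneg (hΨ₁.nonneg (hφ₂.nonneg hho₀))
    have hβ0 : 0 ≤ e (Real.exp (C - k * clock γ t₀ t) * E (Ψ₁ (φ₂ (ho t₀ x₀)))) :=
      he.nonneg (mul_nonneg (Real.exp_pos _).le hG)
    have hhV : h t (x t) ≤ e₁ (V t (x t)) := by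
      rw [← heφ₁ _ (hh t ht0 (x t))]
      exact he₁.mono (hφ₁.nonneg (hh t ht0 _)) (hbounds t ht0 (x t)).1
    have htraj : IsHybridTrajectory γ (fun t => V t (x t)) (potential φ) p ψ (χ R) (δ R) t₀ t := by
      refine isHybridTrajectory_of_isSolution hV.locallyLipschitz hV0 hφ hp hΨ hψΨ hχ hπ hdec hx
        ht₀ htT hRpos ?_ ?_ (by simp only [hδdef]; linarith) (by simp only [hδdef]; linarith)
      · filter_upwards [ae_norm_le_inputNorm hu hγ ht₀ t] with r h1 hr using (h1 hr).trans hR.le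
      · exact fun τ hτ => (norm_le_inputNorm hu hγ ht₀ hτ).trans hR.le
    have hsmall : V t (x t) ≤ Ψ₁ (δ R) → h t (x t) ≤
        e₁ (e (Real.exp (C - k * clock γ t₀ t) * E (Ψ₁ (φ₂ (ho t₀ x₀))))) + e₁ (Ψ₁ (δ R)) :=
      fun hle => (hhV.trans (he₁.mono (hV0 t ht0 _) hle)).trans
        (le_add_of_nonneg_left (he₁.nonneg hβ0))
    rcases htraj.controlledFrom hγ hφ.strictMonoOn_potential hφ.continuousOn_potential hV.p_nonneg
      hp hΨ hψΨ hV.ψ_classP.pos hMpot ht₀ hχR (by simp only [hδdef]; linarith) t ⟨ht, le_rfl⟩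
      with hle | ⟨r, hr, hrd, hGr⟩
    · exact hsmall (hle.trans (hidΨ₁ _ hδR))
    have hb := hbound r hr.1 hr.2 hGr
    rcases hrd with rfl | hrd
    · obtain ⟨hW₀, hWt, hP, -⟩ := hGr
      have hV₀ : V r (x r) ≤ φ₂ (ho r x₀) := by
        rw [hx.initial]
        exact (hbounds r ht₀ x₀).2
      have hmul : E (V t (x t)) ≤
          Real.exp (C - k * clock γ r t) * E (Ψ₁ (φ₂ (ho r x₀))) := by
        have hmono : E (Ψ₁ (V r (x r))) ≤ E (Ψ₁ (φ₂ (ho r x₀))) :=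
          hE.mono (hΨ₁.nonneg hW₀.le) (hΨ₁.mono hW₀.le hV₀)
        rcases hb with hle | ⟨hCk, hle⟩
        · refine (hEpot _ _ hWt hle).trans (mul_le_mul ?_ ?_ (hE.nonneg hW₀.le) (Real.exp_pos _).le)
          · have := hdecay γ hγS r t ht₀ ht
            exact Real.exp_le_exp.2 (by linarith)
          · exact (hE.mono hW₀.le (hidΨ₁ _ hW₀.le)).trans hmono
        · exact ((hE.mono hWt.le hle).trans hmono).trans
            (le_mul_of_one_le_left hG (Real.one_le_exp (by linarith)))
      refine (hhV.trans (he₁.mono hWt.le ?_)).trans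
        (le_add_of_nonneg_right (he₁.nonneg (hΨ₁.nonneg hδR)))
      rw [← heE (V t (x t)) hWt.le]
      exact he.mono (hE.nonneg hWt.le) hmul
    · refine hsmall ?_
      have hWr := hGr.1.le
      rcases hb with hle | ⟨-, hle⟩
      · exact (hle.trans hrd).trans (hidΨ₁ _ hδR)
      · exact hle.trans (hΨ₁.mono hWr hrd)
  have hlim : Tendsto (fun R => e₁ (e (Real.exp (C - k * clock γ t₀ t) * E (Ψ₁ (φ₂ (ho t₀ x₀)))))
      + e₁ (Ψ₁ (δ R))) (𝓝[>] R₀) (𝓝 (e₁ (e (Real.exp (C - k * clock γ t₀ t) *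
        E (Ψ₁ (φ₂ (ho t₀ x₀))))) + e₁ (Ψ₁ (δ R₀)))) :=
    tendsto_const_nhds.add ((hρ.continuousOn R₀ hR₀0).mono
      fun R (hR : R₀ < R) => hR₀0.trans hR.le)
  exact ge_of_tendsto hlim (eventually_nhdsWithin_of_forall key)

end

/-! ### Linear bounds on the number of impulses -/

/-- Lengthening the interval by `T` makes the frequency bound applicable and can only add impulses.
-/
lemma IsUniformSubset.exists_linear_bound {S : Set (Set ℝ)} {ρ ε : ℝ} (hS : IsUniformSubset S ρ)
    (hε : 0 < ε) : ∃ T, 0 < T ∧ ∀ γ ∈ S, ∀ s t, 0 ≤ s → s ≤ t →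
      (numImpulses γ s t : ℝ) ≤ (ρ + ε) * (t - s + T) := by
  obtain ⟨T, hT, h⟩ := hS.2 ε hε
  refine ⟨T, hT, fun γ hγ s t hs hst => ?_⟩
  have hpos : 0 < t - s + T := by linarith
  have h1 := h γ hγ (t - s + T) (by linarith) s hs
  rw [div_le_iff₀ hpos] at h1
  refine le_trans ?_ h1
  exact_mod_cast numImpulses_mono (hS.1 hγ).1 hs (by linarith)

/-- The interval is covered by `⌈t - s⌉` unit intervals, each with at most `η 1` impulses. -/
lemma IsUIB.exists_linear_bound {S : Set (Set ℝ)} (hS : IsUIB S) :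
    ∃ B, 0 ≤ B ∧ ∀ γ ∈ S, ∀ s t, 0 ≤ s → s ≤ t →
      (numImpulses γ s t : ℝ) ≤ B * (t - s + 1) := by
  obtain ⟨hSΓ, η, -, -, hη0, hη⟩ := hS
  refine ⟨η 1, hη0 1 one_pos, fun γ hγ s t hs hst => ?_⟩
  have hstep : ∀ j : ℕ, (numImpulses γ s (s + j) : ℝ) ≤ η 1 * j := by
    intro j
    induction j with
    | zero => simp [numImpulses]
    | succ j ih =>
      have h1 := hη γ hγ (s + j) (s + j + 1) (by positivity) (by linarith)
      rw [add_sub_cancel_left] at h1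
      have h2 := numImpulses_add (hSΓ hγ) hs (s := s + j) (t := s + j + 1)
        (le_add_of_nonneg_right j.cast_nonneg) (by linarith)
      push_cast
      rw [← add_assoc, h2]
      push_cast
      linarith
  have hceil : t - s ≤ ⌈t - s⌉₊ := Nat.le_ceil _
  calc (numImpulses γ s t : ℝ) ≤ numImpulses γ s (s + ⌈t - s⌉₊) := by
        exact_mod_cast numImpulses_mono (hSΓ hγ) hs (by linarith)
    _ ≤ η 1 * ⌈t - s⌉₊ := hstep _
    _ ≤ η 1 * (t - s + 1) := mul_le_mul_of_nonneg_left
        (Nat.ceil_lt_add_one (sub_nonneg.2 hst)).le (hη0 1 one_pos)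

lemma ClassKInf.iterate_le_iterate {Ψ : ℝ → ℝ} (hΨ : ClassKInf Ψ)
    (hid : ∀ w, 0 ≤ w → w ≤ Ψ w) {i j : ℕ} (hij : i ≤ j) {w : ℝ} (hw : 0 ≤ w) :
    Ψ^[i] w ≤ Ψ^[j] w := by
  induction j, hij using Nat.le_induction with
  | base => exact le_rfl
  | succ j _ ih =>
    rw [Function.iterate_succ_apply']
    exact ih.trans (hid _ ((hΨ.iterate j).nonneg hw))

/-- If the potential does not increase at impulses, then the jump rate function is at most the
identity. -/
lemma ClassP.le_self_of_integral_nonpos {φ ψ : ℝ → ℝ} (hφ : ClassP φ) (hψ : ClassP ψ)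
    (h : ∀ a, 0 < a → ∫ s in a..(ψ a), 1 / φ s ≤ 0) {w : ℝ} (hw : 0 ≤ w) : ψ w ≤ w := by
  rcases hw.eq_or_lt with rfl | hw
  · exact hψ.zero.le
  have := h w hw
  rw [← hφ.potential_sub hw (hψ.pos w hw)] at this
  exact (hφ.strictMonoOn_potential.le_iff_le (hψ.pos w hw) hw).1 (by linarith)

end ImpulsiveISS

/-! ### The three cases. -/

theorem theorem1 {n m : ℕ}
    (f g : ℝ → EuclideanSpace ℝ (Fin n) → EuclideanSpace ℝ (Fin m) → EuclideanSpace ℝ (Fin n))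
    (hf : ∀ u ∈ Inputs m, IsCaratheodory (fun t ξ => f t ξ (u t)))
    (ho h : ℝ → EuclideanSpace ℝ (Fin n) → ℝ)
    (hho : ∀ t, 0 ≤ t → ∀ ξ, 0 ≤ ho t ξ) (hh : ∀ t, 0 ≤ t → ∀ ξ, 0 ≤ h t ξ)
    (V : ℝ → EuclideanSpace ℝ (Fin n) → ℝ) (p φ ψ : ℝ → ℝ)
    (hV : IsISSLyapunovCandidate f g ho h V p φ ψ)
    (hφ : ClassP φ) (hψ : ClassP ψ)
    (θ : ℝ) (hθ : 0 < θ) (M N : ℝ)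
    (hM : IsLUB ((fun a : ℝ => ∫ s in a..(ψ a), 1 / φ s) '' Ioi 0) M)
    (hN : IsGLB ((fun t : ℝ => ∫ s in t..(t + θ), p s) '' Ici 0) N)
    (hMN : M < N) :
    (0 < M → ∀ S : Set (Set ℝ), IsUniformSubset S (1 / θ) → StronglyISS f g ho h S) ∧
    (M = 0 → WeaklyISS f g ho h ImpulseSeqs ∧
      ∀ S : Set (Set ℝ), IsUIB S → StronglyISS f g ho h S) ∧
    (M < 0 → 0 < N → StronglyISS f g ho h ImpulseSeqs) := by
  have hMle : ∀ a, 0 < a → ∫ s in a..(ψ a), 1 / φ s ≤ M := fun a ha => hM.1 ⟨a, ha, rfl⟩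
  have hNle : ∀ t, 0 ≤ t → N ≤ ∫ s in t..(t + θ), p s := fun t ht => hN.1 ⟨t, ht, rfl⟩
  have hpint : 0 < N → ∀ s t, 0 ≤ s → s ≤ t → N / θ * (t - s) - N ≤ ∫ r in s..t, p r :=
    fun hN0 s t hs hst => linear_le_integral hV.p_nonneg
      (fun a b => intervalIntegrable_of_locallyIntegrableOn_Ici hV.p_locallyIntegrable)
      hθ hNle hN0.le hs hst
  have hself : M ≤ 0 → ∀ w, 0 ≤ w → ψ w ≤ w := fun hM0 w hw =>
    hφ.le_self_of_integral_nonpos hψ (fun a ha => (hMle a ha).trans hM0) hw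
  have hiter : ∀ k : ℕ, ∀ w : ℝ, 0 ≤ w → (fun y : ℝ => y)^[k] w ≤ w := fun k w _ =>
    (Function.iterate_fixed rfl k).le
  refine ⟨fun hM0 S hS => ?_, fun hM0 => ⟨?_, fun S hS => ?_⟩, fun hM0 hN0 => ?_⟩
  · have hN0 := hM0.trans hMN
    obtain ⟨Ψ, hΨ, hidΨ, hψΨ⟩ := exists_classKInf_majorant hψ
    -- The slack `(N - M) / θ` is halved: one half absorbs the excess impulse frequency, since `M *
    -- ε = (N - M) / (2 * θ)`, and the other is `k * (1 + A)`, which pays for a clock counting both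
    -- time and impulses.
    have hε : 0 < (N - M) / (2 * θ * M) := div_pos (sub_pos.2 hMN) (by positivity)
    obtain ⟨T, hT, hcount⟩ := hS.exists_linear_bound hε
    set A := 1 / θ + (N - M) / (2 * θ * M) with hA
    have hApos : 0 < A := by positivity
    set k := (N - M) / (2 * θ) / (1 + A) with hk
    have hkpos : 0 < k := div_pos (div_pos (sub_pos.2 hMN) (by positivity)) (by positivity)
    have hrate : N / θ = (M + k) * A + k := by
      have h1 : k * (1 + A) = (N - M) / (2 * θ) := div_mul_cancel₀ _ (by positivity)
      have h2 : M * A = M / θ + (N - M) / (2 * θ) := by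
        rw [hA]
        field_simp
      have h3 : N / θ = M / θ + (N - M) / (2 * θ) + (N - M) / (2 * θ) := by
        field_simp
        ring
      linarith
    set C := N + (M + k) * A * T
    -- When `k * clock ≤ C`, at most `C / k` impulses have occurred.
    refine exists_iss_bound (Ψ₁ := Ψ^[⌈C / k⌉₊]) (C := C) hh hV hho hφ
      hMle (fun γ hγ => (hS.1 hγ).1) (fun γ s t => t - s + (numImpulses γ s t : ℝ)) hkpos hΨ hψΨ
      (hΨ.iterate _) (fun w hw => hΨ.iterate_le_iterate hidΨ (Nat.zero_le _) hw) ?_ ?_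
    · intro γ hγ s t hs hst
      have h1 := hpint hN0 s t hs hst
      rw [hrate] at h1
      have h2 := mul_le_mul_of_nonneg_left (hcount γ hγ s t hs hst) (add_pos hM0 hkpos).le
      simp only [C]
      linarith
    · intro γ hγ s t hs hst hC w hw
      refine hΨ.iterate_le_iterate hidΨ ?_ hw
      have h1 : (numImpulses γ s t : ℝ) ≤ C / k := by
        rw [le_div_iff₀ hkpos]
        have := mul_nonneg hkpos.le (sub_nonneg.2 hst)
        linarith
      exact_mod_cast h1.trans (Nat.le_ceil _)
  · have hN0 : 0 < N := hM0 ▸ hMN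
    refine exists_iss_bound (C := N) (k := N / θ) hh hV hho hφ hMle
      Subset.rfl (fun _ s t => t - s) (by positivity) ClassKInf.id (hself hM0.le) ClassKInf.id
      (fun _ _ => le_rfl) ?_ (fun γ _ s t _ _ _ => hiter _)
    · intro γ _ s t hs hst
      rw [hM0]
      linarith [hpint hN0 s t hs hst]
  · have hN0 : 0 < N := hM0 ▸ hMN
    obtain ⟨B, hB, hcount⟩ := hS.exists_linear_bound
    -- The time decay `N / θ` is shared between time and the at most `B` impulses per unit of time.
    set k := N / θ / (1 + B)
    have hkpos : 0 < k := by positivity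
    have hrate : N / θ = k * (1 + B) := (div_mul_cancel₀ _ (by positivity)).symm
    refine exists_iss_bound (C := N + k * B) (k := k) hh hV hho hφ hMle
      hS.1 (fun γ s t => t - s + (numImpulses γ s t : ℝ)) hkpos ClassKInf.id (hself hM0.le)
      ClassKInf.id (fun _ _ => le_rfl) ?_ (fun γ _ s t _ _ _ => hiter _)
    · intro γ hγ s t hs hst
      have h1 := hpint hN0 s t hs hst
      rw [hrate] at h1
      have h2 := mul_le_mul_of_nonneg_left (hcount γ hγ s t hs hst) hkpos.le
      rw [hM0]
      linarith
  -- Flows and jumps both lower the potential, so no restriction on the impulse times is needed.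
  · set k := min (N / θ) (-M)
    have hkpos : 0 < k := lt_min (by positivity) (neg_pos.2 hM0)
    refine exists_iss_bound (C := N) (k := k) hh hV hho hφ hMle
      Subset.rfl (fun γ s t => t - s + (numImpulses γ s t : ℝ)) hkpos ClassKInf.id (hself hM0.le)
      ClassKInf.id (fun _ _ => le_rfl) ?_ (fun γ _ s t _ _ _ => hiter _)
    · intro γ _ s t hs hst
      have h1 := hpint hN0 s t hs hst
      have h2 := mul_le_mul_of_nonneg_right (min_le_left (N / θ) (-M)) (sub_nonneg.2 hst)
      have h3 := mul_le_mul_of_nonneg_right (min_le_right (N / θ) (-M))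
        (Nat.cast_nonneg (α := ℝ) (numImpulses γ s t))
      simp only [k]
      linarith
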